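/- Let $\Xi=[\xi_1\cdots\xi_n]$ be a real $s\times n$ matrix of rank $s$ with nonzero columns. **Kernel matrices.** For a matrix $A$ with $p$ columns, $\ker A$ denotes a matrix with $p$ rows whose columns form a basis of the null space of $A$ and which is in column echelon form (the topmost nonzero entry of each column lies strictly below that of the preceding column). Any such choices are allowed below. Write $K=\ker\Xi$, an $n\times(n-s)$ matrix. **The vectors $\nu_\alpha$.** For $\alpha\in\mathbb Z_{\ge0}^n$ let $\|\alpha\|_0$ be the number of its nonzero entries. For every $\alpha$ with $s<\|\alpha\|_0\le n$ fix a vector $\nu_\alpha\in\mathbb R^n$ as follows. If $\|\alpha\|_0=n$, then $\nu_\alpha$ is the first column of $K$. If $\|\alpha\|_0<n$, let $C_\alpha$ consist of the rows of $K$ with index $j$ such that $\alpha(j)=0$; then $\nu_\alpha=K t_\alpha$, where $t_\alpha$ is the first column of a matrix $\ker C_\alpha$. Put $m_\alpha=\min\{i:\nu_\alpha(i)\ne0\}$. **The families $P_k$.** Let $P_0=\{(1,(1,\dots,1))\}$, and for $1\le k\le n-s$ let $P_k$ be the finite family (pairs counted with multiplicity) of all $$\Bigl(-c\,\frac{\nu_\alpha(j)}{\nu_\alpha(m_\alpha)},\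 r_j(\alpha)\Bigr),\qquad (c,\alpha)\in P_{k-1},\quad m_\alpha<j\le n,\quad \nu_\alpha(j)\neq0,$$ where $r_j(\alpha)$ is $\alpha$ with entry $m_\alpha$ increased by $1$ and entry $j$ decreased by $1$. **The summands.** For $\|\alpha\|_0=s$ let $\mu_\alpha\in\mathbb Z_{>0}^s$ be the vector of nonzero entries of $\alpha$, in order, and let $\Xi_\alpha$ be the $s\times s$ matrix of the columns $\xi_j$ of $\Xi$ with $\alpha(j)\ne0$, in order. For $y\in\mathbb R^s$ and $\kappa\in\mathbb Z_{\ge0}^s$ put $$(y)_{\mathrm{sgn}}^{\kappa}=\prod_{j=1}^s\frac{\tfrac12\operatorname{sgn}(y(j))\,y(j)^{\kappa(j)}}{\kappa(j)!}.$$ **Claim.** For every $(c,\alpha)$ in $P_{n-s}$ one has $\|\alpha\|_0=s$ and $\det\Xi_\alpha\ne0$, so that $$G_\Xi(x)=\sum_{(c,\alpha)\in P_{n-s}}\frac{c}{|\det\Xi_\alpha|}\,\bigl(\Xi_\alpha^{-1}x\bigr)_{\mathrm{sgn}}^{\mu_\alpha-1}$$ is well defined, and $G_\Xi$ is a spatial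 Green's function of $\Xi$ in the following sense. It is a measurable function of polynomial growth on $\mathbb R^s$ whose Fourier transform, in the convention $\hat f(\omega)=\int f(x)e^{-i\omega\cdot x}\,dx$ extended to tempered distributions, is $\widehat{G_\Xi}(\omega)=\prod_{j=1}^n\frac1{i\,\xi_j\cdot\omega}$. That is, $\widehat{G_\Xi}$ agrees with this function on the open set where all $\xi_j\cdot\omega\neq0$, and $\bigl(\prod_{j=1}^n i\,\xi_j\cdot\omega\bigr)\widehat{G_\Xi}=1$ as tempered distributions on $\mathbb R^s$ (equivalently, applying the directional derivatives along $\xi_1,\dots,\xi_n$ to $G_\Xi$ gives the Dirac distribution at $0$). -/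

import Mathlib

open MeasureTheory Complex
open scoped Matrix SchwartzMap

namespace BoxSpline

/-- Column echelon form (no zero columns): the topmost nonzero entry of each column lies
strictly below the topmost nonzero entry of the preceding column. -/
def IsColumnEchelon {p q : ℕ} (M : Matrix (Fin p) (Fin q) ℝ) : Prop :=
  ∃ piv : Fin q → Fin p, StrictMono piv ∧
    ∀ j, M (piv j) j ≠ 0 ∧ ∀ i, i < piv j → M i j = 0

/-- `N` is a matrix `ker A`: its columns form a basis of the null space of `A`,
and it is in column echelon form. -/
structure IsKernelMatrix {ι : Type*} {p q : ℕ} (A : Matrix ι (Fin p) ℝ)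
    (N : Matrix (Fin p) (Fin q) ℝ) : Prop where
  linearIndependent : LinearIndependent ℝ N.col
  span_eq : Submodule.span ℝ (Set.range N.col) = LinearMap.ker A.mulVecLin
  echelon : IsColumnEchelon N

/-- The indices of the nonzero entries of `α`; its cardinality is `‖α‖₀`. -/
def supp {n : ℕ} (α : Fin n → ℕ) : Finset (Fin n) := Finset.univ.filter fun i => α i ≠ 0

/-- The rows `b'_j` of `K` with `α(j) = 0`. -/
def cMatrix {n r : ℕ} (K : Matrix (Fin n) (Fin r) ℝ) (α : Fin n → ℕ) :
    Matrix {j : Fin n // α j = 0} (Fin r) ℝ :=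
  K.submatrix Subtype.val id

/-- `v` is a vector `ν_α` formed from `K = ker Ξ`: if `‖α‖₀ = n` it is the first column
of `K`; if `‖α‖₀ < n` it is `K t` with `t` the first column of a matrix `ker C_α`. -/
def IsNuVector {n r : ℕ} (K : Matrix (Fin n) (Fin r) ℝ) (α : Fin n → ℕ)
    (v : Fin n → ℝ) : Prop :=
  ((supp α).card = n → ∃ j : Fin r, (j : ℕ) = 0 ∧ v = K.col j) ∧
  ((supp α).card < n → ∃ (q : ℕ) (T : Matrix (Fin r) (Fin q) ℝ),
    IsKernelMatrix (cMatrix K α) T ∧ ∃ j : Fin q, (j : ℕ) = 0 ∧ v = K *ᵥ T.col j)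

/-- `m = min {i : v i ≠ 0}`. -/
def IsLead {n : ℕ} (v : Fin n → ℝ) (m : Fin n) : Prop :=
  v m ≠ 0 ∧ ∀ i, i < m → v i = 0

/-- The map `r_j` with leading index `m`: raise entry `m` by one, lower entry `j` by one.
It is used only for `m < j` and `ν_α(j) ≠ 0`, which forces `α(j) ≥ 1`. -/
def shift {n : ℕ} (m j : Fin n) (α : Fin n → ℕ) : Fin n → ℕ :=
  fun i => if i = m then α i + 1 else if i = j then α i - 1 else α i

open Classical in
/-- The pairs obtained from one pair `(c, α)`: one for each `j > m_α` with `ν_α(j) ≠ 0`. -/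
noncomputable def children {n : ℕ} (ν : (Fin n → ℕ) → Fin n → ℝ) (a : ℝ × (Fin n → ℕ)) :
    Multiset (ℝ × (Fin n → ℕ)) :=
  ((Finset.univ : Finset (Fin n × Fin n)).filter fun p =>
      IsLead (ν a.2) p.1 ∧ p.1 < p.2 ∧ ν a.2 p.2 ≠ 0).val.map fun p =>
    (-a.1 * (ν a.2 p.2 / ν a.2 p.1), shift p.1 p.2 a.2)

/-- The families `P_k`; a pair that arises several times is counted with multiplicity. -/
noncomputable def P {n : ℕ} (ν : (Fin n → ℕ) → Fin n → ℝ) :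
    ℕ → Multiset (ℝ × (Fin n → ℕ))
  | 0 => {(1, fun _ => 1)}
  | k + 1 => (P ν k).bind (children ν)

/-- `σ_α`: the increasing enumeration of the indices of the nonzero entries of `α`. -/
def sigma {s n : ℕ} (α : Fin n → ℕ) (h : (supp α).card = s) : Fin s ↪o Fin n :=
  (supp α).orderEmbOfFin h

/-- `μ_α`: the nonzero entries of `α`, in order. -/
def mu {s n : ℕ} (α : Fin n → ℕ) (h : (supp α).card = s) (j : Fin s) : ℕ :=
  α (sigma α h j)

/-- `Ξ_α`: the columns of `Ξ` at the nonzero entries of `α`, in order. -/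
def subMatrix {s n : ℕ} (Ξ : Matrix (Fin s) (Fin n) ℝ) (α : Fin n → ℕ)
    (h : (supp α).card = s) : Matrix (Fin s) (Fin s) ℝ :=
  Ξ.submatrix id (sigma α h)

/-- The signed power `(x)_sgn^k = sgn(x) x^k / 2`. -/
noncomputable def sgnPow (x : ℝ) (k : ℕ) : ℝ := Real.sign x * x ^ k / 2

/-- The normalized signed power `∏ j, (y j)_sgn^(k j) / (k j)!` of a vector. -/
noncomputable def sgnPowVec {s : ℕ} (y : Fin s → ℝ) (k : Fin s → ℕ) : ℝ :=
  ∏ j, sgnPow (y j) (k j) / ((k j).factorial : ℝ)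

/-- The summand for `(c, α)`, where `‖α‖₀ = s`; the value in the other case is never used. -/
noncomputable def greensTerm {s n : ℕ} (Ξ : Matrix (Fin s) (Fin n) ℝ)
    (a : ℝ × (Fin n → ℕ)) (x : EuclideanSpace ℝ (Fin s)) : ℝ :=
  if h : (supp a.2).card = s then
    a.1 / |(subMatrix Ξ a.2 h).det| *
      sgnPowVec ((subMatrix Ξ a.2 h)⁻¹ *ᵥ x.ofLp) (fun j => mu a.2 h j - 1)
  else 0

/-- The sum over `(c, α) ∈ P_{n-s}`. -/
noncomputable def greensSum {s n : ℕ} (Ξ : Matrix (Fin s) (Fin n) ℝ)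
    (ν : (Fin n → ℕ) → Fin n → ℝ) (x : EuclideanSpace ℝ (Fin s)) : ℝ :=
  ((P ν (n - s)).map fun a => greensTerm Ξ a x).sum

/-- `∏ j, w(j)` with `w(j) = i ξ_j · ω`; the Fourier form of the Green's function is its
reciprocal. -/
noncomputable def symbol {s n : ℕ} (Ξ : Matrix (Fin s) (Fin n) ℝ)
    (ω : EuclideanSpace ℝ (Fin s)) : ℂ :=
  ∏ j, (I * ((∑ i, Ξ i j * ω i : ℝ) : ℂ))

/-- Fourier transform in the convention `∫ f(ω) exp(-i ω · x) dω`. -/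
noncomputable def angularFourier {s : ℕ} (f : EuclideanSpace ℝ (Fin s) → ℂ)
    (x : EuclideanSpace ℝ (Fin s)) : ℂ :=
  ∫ ω, Complex.exp (-(I * ((inner ℝ ω x : ℝ) : ℂ))) * f ω

/-- `G` is a Green's function of `Ξ`: a function of polynomial growth whose Fourier transform
`Ĝ`, the tempered distribution `φ ↦ ∫ G(x) φ̂(x) dx`, is `1 / ∏ j, (i ξ_j · ω)`. That is,
`Ĝ` agrees with this function on the open set where it is defined, and `(∏ j, i ξ_j · ω) Ĝ = 1`
as tempered distributions on the whole space (equivalently, applying the directional derivatives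
along all the `ξ_j` to `G` gives the Dirac distribution). -/
structure IsGreensFunction {s n : ℕ} (Ξ : Matrix (Fin s) (Fin n) ℝ)
    (G : EuclideanSpace ℝ (Fin s) → ℝ) : Prop where
  measurable : Measurable G
  growth : ∃ (C : ℝ) (N : ℕ), ∀ x, |G x| ≤ C * (1 + ‖x‖) ^ N
  fourier_eq_off_zeros : ∀ φ : 𝓢(EuclideanSpace ℝ (Fin s), ℂ), HasCompactSupport φ →
    tsupport φ ⊆ {ω | symbol Ξ ω ≠ 0} →
    ∫ x, (G x : ℂ) * angularFourier φ x = ∫ ω, φ ω / symbol Ξ ω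
  symbol_mul_fourier : ∀ φ : 𝓢(EuclideanSpace ℝ (Fin s), ℂ),
    ∫ x, (G x : ℂ) * angularFourier (fun ω => symbol Ξ ω * φ ω) x = ∫ ω, φ ω

end BoxSpline

/-! Write w(j) = i ξ_j · ω. A relation ν among the columns gives ∑ ν(j) w(j) = 0, hence 1 = -∑_{j>m}
(ν(j)/ν(m)) w(j)/w(m) for the leading index m. Multiplying 1/w^α by this replaces it by terms in
which m is raised and j lowered. The relation `ν α` has the smallest leading index among relations
on the support of α, so every j > m still has exponent at most 1 (`IsNode`). Each step therefore
deletes exactly one index, and spanning survives because the deleted column is a combination of the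
remaining ones. After n - s steps the columns left form a basis.

The difficulty is to make this rigorous for distributions. The functional T_γ = 1/w^γ is realised by
integrating the Fourier transform of the test function against one-dimensional signed-power kernels
along the columns. Convergence is available only when the columns on the support of γ are
independent, so the intermediate 1/w^α are never formed. Instead,
`IsReciprocalSystem.descendantSum_eq` shows by induction that the descendants of (c, α), applied to
w^(α-γ) φ, sum to c T_γ(φ), where γ ≤ α lives on indices that no relation on α can precede. Such γ
are independent since columns are nonzero. Taking α = (1,…,1) and γ = 0 gives T_0(φ) = ∫ φ, which is
the identity `symbol_mul_fourier`.

The analytic input is `integral_kern_succ_mul_deriv` in one variable, carried to the columns by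
`kernIntegral_add_single`. For a basis, `integral_greensTerm_mul` identifies the functional with the
summand by a linear change of variables. -/

namespace BoxSpline

/-- `v` is a linear relation among the columns of `Ξ` at the nonzero entries of `α`. -/
def IsRelation {s n : ℕ} (Ξ : Matrix (Fin s) (Fin n) ℝ) (α : Fin n → ℕ) (v : Fin n → ℝ) : Prop :=
  Ξ *ᵥ v = 0 ∧ ∀ i, α i = 0 → v i = 0

/-- The columns of `Ξ` at the nonzero entries of `α` are linearly independent. -/
def IsIndep {s n : ℕ} (Ξ : Matrix (Fin s) (Fin n) ℝ) (α : Fin n → ℕ) : Prop :=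
  ∀ v, IsRelation Ξ α v → v = 0

/-! ### Column relations, echelon form and the invariants of the multi-indices -/

section Relations

variable {s n r : ℕ} {Ξ : Matrix (Fin s) (Fin n) ℝ}

theorem mem_supp {α : Fin n → ℕ} {i : Fin n} : i ∈ supp α ↔ α i ≠ 0 := by simp [supp]

theorem mem_range_sigma {α : Fin n → ℕ} (hα : (supp α).card = s) {i : Fin n} :
    i ∈ Set.range (sigma α hα) ↔ α i ≠ 0 := by
  rw [sigma, Finset.range_orderEmbOfFin]
  exact mem_supp

theorem IsRelation.mono {α β : Fin n → ℕ} (h : ∀ i, α i = 0 → β i = 0) {v : Fin n → ℝ}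
    (hv : IsRelation Ξ β v) : IsRelation Ξ α v :=
  ⟨hv.1, fun i hi => hv.2 i (h i hi)⟩

theorem IsIndep.mono {α β : Fin n → ℕ} (h : ∀ i, α i = 0 → β i = 0) (hα : IsIndep Ξ α) :
    IsIndep Ξ β :=
  fun v hv => hα v (hv.mono h)

theorem IsLead.unique {v : Fin n → ℝ} {m m' : Fin n} (h : IsLead v m) (h' : IsLead v m') :
    m = m' :=
  le_antisymm (not_lt.1 fun hlt => h'.1 (h.2 _ hlt)) (not_lt.1 fun hlt => h.1 (h'.2 _ hlt))

theorem exists_isLead {v : Fin n → ℝ} (hv : v ≠ 0) : ∃ m, IsLead v m := by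
  classical
  obtain ⟨i, hi⟩ := Function.ne_iff.1 hv
  have hne : (Finset.univ.filter fun i => v i ≠ 0).Nonempty := ⟨i, by simpa using hi⟩
  refine ⟨_, (Finset.mem_filter.1 (Finset.min'_mem _ hne)).2, fun j hj => ?_⟩
  by_contra hvj
  exact absurd (Finset.min'_le _ j (by simpa using hvj)) (not_le.2 hj)

theorem IsKernelMatrix.exists_mulVec {ι : Type*} {p q : ℕ} {A : Matrix ι (Fin p) ℝ}
    {N : Matrix (Fin p) (Fin q) ℝ} (h : IsKernelMatrix A N) {u : Fin p → ℝ} (hu : A *ᵥ u = 0) :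
    ∃ t, u = N *ᵥ t := by
  have hmem : u ∈ LinearMap.ker A.mulVecLin := hu
  rw [← h.span_eq, ← Matrix.range_mulVecLin] at hmem
  obtain ⟨t, ht⟩ := hmem
  exact ⟨t, ht.symm⟩

theorem IsKernelMatrix.mulVec_mulVec {ι : Type*} {p q : ℕ} {A : Matrix ι (Fin p) ℝ}
    {N : Matrix (Fin p) (Fin q) ℝ} (h : IsKernelMatrix A N) (t : Fin q → ℝ) :
    A *ᵥ (N *ᵥ t) = 0 := by
  have hmem : N *ᵥ t ∈ LinearMap.ker A.mulVecLin := by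
    rw [← h.span_eq, ← Matrix.range_mulVecLin]
    exact ⟨t, rfl⟩
  exact hmem

/-- Pivots increase, so columns from l onward are still zero above the pivot of l. Applied to `K`
and then to `ker C_α`, this makes the leading index of `ν_α` minimal. -/
theorem mulVec_eq_zero_of_lt_pivot {p q : ℕ} {M : Matrix (Fin p) (Fin q) ℝ} {piv : Fin q → Fin p}
    (hmono : StrictMono piv) (hpiv : ∀ j, M (piv j) j ≠ 0 ∧ ∀ i, i < piv j → M i j = 0)
    {t : Fin q → ℝ} {l : Fin q} (ht : ∀ j, j < l → t j = 0) {i : Fin p} (hi : i < piv l) :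
    (M *ᵥ t) i = 0 := by
  rw [Matrix.mulVec_eq_sum, Finset.sum_apply]
  refine Finset.sum_eq_zero fun j _ => ?_
  rcases lt_or_ge j l with hj | hj
  · simp [ht j hj]
  · simp [(hpiv j).2 i (hi.trans_le (hmono.monotone hj))]

theorem isLead_mulVec {p q : ℕ} {M : Matrix (Fin p) (Fin q) ℝ} {piv : Fin q → Fin p}
    (hmono : StrictMono piv) (hpiv : ∀ j, M (piv j) j ≠ 0 ∧ ∀ i, i < piv j → M i j = 0)
    {t : Fin q → ℝ} {l : Fin q} (ht : IsLead t l) : IsLead (M *ᵥ t) (piv l) := by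
  refine ⟨?_, fun i hi => mulVec_eq_zero_of_lt_pivot hmono hpiv ht.2 hi⟩
  have : (M *ᵥ t) (piv l) = M (piv l) l * t l := by
    change ∑ j, M (piv l) j * t j = _
    refine Finset.sum_eq_single l (fun j _ hj => ?_) (by simp)
    rcases lt_or_gt_of_ne hj with hj | hj
    · rw [ht.2 j hj, mul_zero]
    · rw [(hpiv j).2 _ (hmono hj), zero_mul]
  rw [this]
  exact mul_ne_zero (hpiv l).1 ht.1

/-- `ν_α` is a relation whose leading index is minimal among all relations on the support
of `α`. -/
theorem IsNuVector.isRelation_and_isLead {K : Matrix (Fin n) (Fin r) ℝ}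
    (hK : IsKernelMatrix Ξ K) {α : Fin n → ℕ} {v : Fin n → ℝ} (h : IsNuVector K α v) :
    IsRelation Ξ α v ∧ ∃ m, IsLead v m ∧ ∀ u, IsRelation Ξ α u → ∀ i, i < m → u i = 0 := by
  obtain ⟨piv, hmono, hpiv⟩ := hK.echelon
  rcases (Finset.card_le_univ (supp α)).lt_or_eq with hlt | heq
  · obtain ⟨q, T, hT, j, hj, rfl⟩ := h.2 (by simpa using hlt)
    obtain ⟨pivT, hmonoT, hpivT⟩ := hT.echelon
    have hc : ∀ t, cMatrix K α *ᵥ t = 0 ↔ ∀ i, α i = 0 → (K *ᵥ t) i = 0 := fun t =>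
      ⟨fun h i hi => congrFun h ⟨i, hi⟩, fun h => funext fun i => h i.1 i.2⟩
    have hTj : T.col j = T *ᵥ Pi.single j 1 := by simp
    refine ⟨⟨hK.mulVec_mulVec _, (hc _).1 ?_⟩, piv (pivT j), ?_, fun u hu i hi => ?_⟩
    · rw [hTj]
      exact hT.mulVec_mulVec _
    · exact isLead_mulVec hmono hpiv (hpivT j)
    · obtain ⟨t, rfl⟩ := hK.exists_mulVec hu.1
      obtain ⟨w, rfl⟩ := hT.exists_mulVec ((hc t).2 hu.2)
      refine mulVec_eq_zero_of_lt_pivot hmono hpiv (fun l hl => ?_) hi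
      -- Here j is the first column, so the condition on earlier coefficients is vacuous.
      refine mulVec_eq_zero_of_lt_pivot hmonoT hpivT (l := j) (fun l' hl' => ?_) hl
      exact absurd (Fin.lt_def.1 hl') (by omega)
  · obtain ⟨j, hj, rfl⟩ := h.1 (by simpa using heq)
    have huniv : supp α = Finset.univ := Finset.card_eq_iff_eq_univ _ |>.1 heq
    have hKj : K.col j = K *ᵥ Pi.single j 1 := by simp
    refine ⟨⟨?_, fun i hi => absurd hi (mem_supp.1 (huniv ▸ Finset.mem_univ i))⟩, piv j,
      hpiv j, fun u hu i hi => ?_⟩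
    · rw [hKj]
      exact hK.mulVec_mulVec _
    · obtain ⟨t, rfl⟩ := hK.exists_mulVec hu.1
      refine mulVec_eq_zero_of_lt_pivot hmono hpiv (l := j) (fun l' hl' => ?_) hi
      exact absurd (Fin.lt_def.1 hl') (by omega)

/-- The columns of `Ξ` at the nonzero entries of `α` span, in dual form. -/
def IsSpanning (Ξ : Matrix (Fin s) (Fin n) ℝ) (α : Fin n → ℕ) : Prop :=
  ∀ y : Fin s → ℝ, (∀ i, α i ≠ 0 → (y ᵥ* Ξ) i = 0) → y = 0

/-- Invariants of the multi-indices in `P_k`. -/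
structure IsNode (Ξ : Matrix (Fin s) (Fin n) ℝ) (k : ℕ) (α : Fin n → ℕ) : Prop where
  card : (supp α).card + k = n
  le_one : ∀ v, IsRelation Ξ α v → ∀ m, IsLead v m → ∀ j, m < j → α j ≤ 1
  spanning : IsSpanning Ξ α

theorem isNode_one (hrank : Ξ.rank = s) : IsNode Ξ 0 (fun _ => 1) := by
  refine ⟨by simp [supp], fun _ _ _ _ _ _ => le_rfl, fun y hy => ?_⟩
  have hli : LinearIndependent ℝ Ξ.row := by
    rw [linearIndependent_iff_card_eq_finrank_span, Fintype.card_fin]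
    exact hrank.symm.trans (Matrix.rank_eq_finrank_span_row Ξ)
  have := Matrix.vecMul_injective_iff.2 hli
  apply this
  exact (funext fun i => hy i one_ne_zero).trans (Matrix.zero_vecMul Ξ).symm

/-- Since α(j) = 1, lowering j removes it from the support, while m was already there. Relations on
the smaller support are relations on the old one, which is what lets the bound `le_one` persist. -/
theorem IsNode.shift {k : ℕ} {α : Fin n → ℕ} (h : IsNode Ξ k α) {v : Fin n → ℝ}
    (hv : IsRelation Ξ α v) {m : Fin n} (hm : IsLead v m)
    (hmin : ∀ u, IsRelation Ξ α u → ∀ i, i < m → u i = 0) {j : Fin n} (hj : m < j)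
    (hvj : v j ≠ 0) : α j = 1 ∧ α m ≠ 0 ∧
      (∀ i, BoxSpline.shift m j α i = 0 ↔ α i = 0 ∨ i = j) ∧
      IsNode Ξ (k + 1) (BoxSpline.shift m j α) := by
  have hαj : α j = 1 :=
    le_antisymm (h.le_one v hv m hm j hj) (Nat.one_le_iff_ne_zero.2 fun h0 => hvj (hv.2 j h0))
  have hαm : α m ≠ 0 := fun h0 => hm.1 (hv.2 m h0)
  have hzero : ∀ i, BoxSpline.shift m j α i = 0 ↔ α i = 0 ∨ i = j := by
    intro i
    unfold BoxSpline.shift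
    split_ifs with h1 h2
    · subst h1
      simp [hαm, hj.ne]
    · subst h2
      simp [hαj]
    · simp [h2]
  have hsub : ∀ i, α i = 0 → BoxSpline.shift m j α i = 0 := fun i hi => (hzero i).2 (Or.inl hi)
  refine ⟨hαj, hαm, hzero, ?_, fun u hu l hl i hi => ?_, fun y hy => h.spanning y ?_⟩
  · have : supp (BoxSpline.shift m j α) = (supp α).erase j := by
      ext i
      rw [Finset.mem_erase, mem_supp, mem_supp, Ne, hzero]
      tauto
    have hjm : j ∈ supp α := mem_supp.2 (by omega)
    have h1 := h.card
    have h2 := Finset.card_erase_add_one hjm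
    rw [this]
    omega
  · have hu' := hu.mono hsub
    -- Minimality of m puts every new leading index at or after m, so the raised entry is never
    -- among those that must be at most 1.
    have hml : m ≤ l := not_lt.1 fun hlm => hl.1 (hmin u hu' l hlm)
    refine le_trans ?_ (h.le_one u hu' l hl i hi)
    unfold BoxSpline.shift
    rw [if_neg (hml.trans_lt hi).ne']
    split_ifs
    · exact Nat.sub_le _ _
    · exact le_rfl
  · have hoff : ∀ i, i ≠ j → α i ≠ 0 → (y ᵥ* Ξ) i = 0 := fun i hij hi =>
      hy i fun h0 => ((hzero i).1 h0).elim hi hij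
    -- Pairing with the relation isolates column j: a functional vanishing on the other columns of
    -- the support also vanishes on column j.
    have hsum : (y ᵥ* Ξ) ⬝ᵥ v = 0 := by
      rw [← Matrix.dotProduct_mulVec, hv.1, dotProduct_zero]
    have hsing : (y ᵥ* Ξ) ⬝ᵥ v = (y ᵥ* Ξ) j * v j := by
      refine Finset.sum_eq_single j (fun i _ hij => ?_) (by simp)
      by_cases hi : α i = 0
      · rw [hv.2 i hi, mul_zero]
      · rw [hoff i hij hi, zero_mul]
    have hyj : (y ᵥ* Ξ) j = 0 := by
      rw [hsing] at hsum
      exact (mul_eq_zero.1 hsum).resolve_right hvj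
    intro i hi
    by_cases hij : i = j
    · rw [hij, hyj]
    · exact hoff i hij hi

theorem IsNode.det_ne_zero {k : ℕ} {α : Fin n → ℕ} (h : IsNode Ξ k α) (hα : (supp α).card = s) :
    (subMatrix Ξ α hα).det ≠ 0 := by
  intro hdet
  obtain ⟨y, hy, hy0⟩ := Matrix.exists_vecMul_eq_zero_iff.2 hdet
  refine hy (h.spanning y fun i hi => ?_)
  obtain ⟨a, ha⟩ := (mem_range_sigma hα).2 hi
  rw [← ha]
  exact congrFun hy0 a

theorem isIndep_of_det_ne_zero {α : Fin n → ℕ} (hα : (supp α).card = s)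
    (hdet : (subMatrix Ξ α hα).det ≠ 0) : IsIndep Ξ α := by
  intro v hv
  have hzero : v ∘ sigma α hα = 0 := by
    refine Matrix.eq_zero_of_mulVec_eq_zero hdet ?_
    rw [← hv.1]
    funext a
    change ∑ b, Ξ a (sigma α hα b) * v (sigma α hα b) = ∑ i, Ξ a i * v i
    rw [← Finset.sum_image (s := Finset.univ) (g := sigma α hα) (f := fun i => Ξ a i * v i)
      (fun _ _ _ _ hab => (sigma α hα).injective hab)]
    refine Finset.sum_subset (Finset.subset_univ _) fun i _ hi => ?_
    rw [hv.2 i, mul_zero]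
    by_contra hne
    obtain ⟨b, hb⟩ := (mem_range_sigma hα).2 hne
    exact hi (Finset.mem_image.2 ⟨b, Finset.mem_univ _, hb⟩)
  funext i
  by_cases hi : α i = 0
  · exact hv.2 i hi
  · obtain ⟨b, hb⟩ := (mem_range_sigma hα).2 hi
    rw [← hb]
    exact congrFun hzero b

end Relations

/-! ### Partial fractions in an abstract system of functionals -/

section Recursion

variable {s n : ℕ} {Ξ : Matrix (Fin s) (Fin n) ℝ}

/-- The sum of `c T_α(φ)` over the `r`-th generation of descendants `(c, α)` of a pair. -/
noncomputable def descendantSum {X : Type*} (ν : (Fin n → ℕ) → Fin n → ℝ)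
    (T : (Fin n → ℕ) → X → ℂ) (φ : X) : ℕ → ℝ × (Fin n → ℕ) → ℂ
  | 0, a => a.1 * T a.2 φ
  | r + 1, a => ((children ν a).map (descendantSum ν T φ r)).sum

/-- `P` appends a generation at the end, `descendantSum` unfolds from the ancestor; this reconciles
the two orders of recursion. -/
theorem sum_P_add {X : Type*} (ν : (Fin n → ℕ) → Fin n → ℝ) (T : (Fin n → ℕ) → X → ℂ) (φ : X)
    (r k : ℕ) : ((P ν (k + r)).map (descendantSum ν T φ 0)).sum =
      ((P ν k).map (descendantSum ν T φ r)).sum := by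
  induction r generalizing k with
  | zero => rfl
  | succ r ih =>
    rw [show k + (r + 1) = (k + 1) + r by ring, ih, P, Multiset.map_bind, Multiset.sum_bind]
    rfl

theorem sum_children {M : Type*} [AddCommMonoid M] (ν : (Fin n → ℕ) → Fin n → ℝ)
    (a : ℝ × (Fin n → ℕ)) {m : Fin n} (hm : IsLead (ν a.2) m) (f : ℝ × (Fin n → ℕ) → M) :
    ((children ν a).map f).sum =
      ∑ j with m < j ∧ ν a.2 j ≠ 0, f (-a.1 * (ν a.2 j / ν a.2 m), shift m j a.2) := by
  classical
  rw [children, Multiset.map_map, ← Finset.sum_eq_multiset_sum]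
  refine Finset.sum_bij' (fun p _ => p.2) (fun j _ => (m, j)) ?_ ?_ ?_ ?_ ?_
  · rintro ⟨m', j⟩ h
    simp only [Finset.mem_filter, Finset.mem_univ, true_and] at h ⊢
    rw [hm.unique h.1]
    exact h.2
  · intro j h
    simp only [Finset.mem_filter, Finset.mem_univ, true_and] at h ⊢
    exact ⟨hm, h⟩
  · rintro ⟨m', j⟩ h
    simp only [Finset.mem_filter, Finset.mem_univ, true_and] at h
    rw [hm.unique h.1]
  · intro j _
    rfl
  · rintro ⟨m', j⟩ h
    simp only [Finset.mem_filter, Finset.mem_univ, true_and] at h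
    rw [hm.unique h.1]
    rfl

theorem mem_children {ν : (Fin n → ℕ) → Fin n → ℝ} {a b : ℝ × (Fin n → ℕ)}
    (hb : b ∈ children ν a) : ∃ m j, IsLead (ν a.2) m ∧ m < j ∧ ν a.2 j ≠ 0 ∧
      b.2 = shift m j a.2 := by
  classical
  rw [children, Multiset.mem_map] at hb
  obtain ⟨⟨m, j⟩, h, rfl⟩ := hb
  rw [Finset.mem_val, Finset.mem_filter] at h
  exact ⟨m, j, h.2.1, h.2.2.1, h.2.2.2, rfl⟩

/-- A nonzero relation on γ with leading index l cannot involve any i > l, because such an i would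
force the entry at l to vanish. It would then be a multiple of a single column, which is nonzero. -/
theorem IsRelation.eq_zero_of_forall_lt {α γ : Fin n → ℕ} (hcol : ∀ j, Ξ.col j ≠ 0)
    (hγα : γ ≤ α) (hγ : ∀ i, γ i ≠ 0 → ∀ u, IsRelation Ξ α u → ∀ l, l < i → u l = 0)
    {v : Fin n → ℝ} (hv : IsRelation Ξ γ v) : v = 0 := by
  by_contra hne
  obtain ⟨l, hl, hlt⟩ := exists_isLead hne
  have hvα : IsRelation Ξ α v := hv.mono fun i hi => Nat.le_zero.1 (hi ▸ hγα i)
  have hvl : v = Pi.single l (v l) := by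
    funext i
    rcases lt_trichotomy i l with hi | rfl | hi
    · rw [hlt i hi, Pi.single_eq_of_ne hi.ne]
    · rw [Pi.single_eq_same]
    · rw [Pi.single_eq_of_ne hi.ne']
      by_contra hvi
      exact hl (hγ i (fun h0 => hvi (hv.2 i h0)) v hvα l hi)
  have hsmul := hv.1
  rw [hvl, Matrix.mulVec_single] at hsmul
  refine hcol l (funext fun a => ?_)
  have := congrFun hsmul a
  simpa [hl] using this

/-- The multiplicativity rules of the functionals `T_γ = 1 / w^γ`, where `W δ` is the
multiplication by `w^δ`. -/
structure IsReciprocalSystem {X : Type*} [AddCommGroup X] [Module ℂ X]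
    (Ξ : Matrix (Fin s) (Fin n) ℝ) (W : (Fin n → ℕ) → X →ₗ[ℂ] X)
    (T : (Fin n → ℕ) → X → ℂ) : Prop where
  mul_zero : ∀ φ, W 0 φ = φ
  mul_add : ∀ δ ε φ, W (δ + ε) φ = W δ (W ε φ)
  sum_eq_zero : ∀ v, Ξ *ᵥ v = 0 → ∀ φ, ∑ j, (v j : ℂ) • W (Pi.single j 1) φ = 0
  isLinearMap : ∀ γ, IsIndep Ξ γ → IsLinearMap ℂ (T γ)
  cancel : ∀ γ i φ, IsIndep Ξ (γ + Pi.single i 1) →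
    T (γ + Pi.single i 1) (W (Pi.single i 1) φ) = T γ φ

namespace IsReciprocalSystem

variable {X : Type*} [AddCommGroup X] [Module ℂ X] {W : (Fin n → ℕ) → X →ₗ[ℂ] X}
  {T : (Fin n → ℕ) → X → ℂ}

theorem cancel_add (h : IsReciprocalSystem Ξ W T) (δ : Fin n → ℕ) :
    ∀ γ, IsIndep Ξ (γ + δ) → ∀ φ, T (γ + δ) (W δ φ) = T γ φ := by
  induction hd : ∑ i, δ i generalizing δ with
  | zero =>
    intro γ _ φ
    have : δ = 0 := funext fun i => (Finset.sum_eq_zero_iff.1 hd) i (Finset.mem_univ i)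
    rw [this, h.mul_zero, add_zero]
  | succ d ih =>
    intro γ hγ φ
    obtain ⟨i, hi⟩ : ∃ i, δ i ≠ 0 := by
      by_contra hne
      push Not at hne
      simp [hne] at hd
    obtain ⟨ε, rfl⟩ : ∃ ε, δ = ε + Pi.single i 1 := by
      refine ⟨δ - Pi.single i 1, (tsub_add_cancel_of_le fun l => ?_).symm⟩
      by_cases hl : l = i
      · subst hl
        simpa using Nat.one_le_iff_ne_zero.2 hi
      · simp [hl]
    rw [add_comm ε, h.mul_add, add_comm _ ε, ← add_assoc, h.cancel _ _ _ (by rwa [add_assoc])]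
    refine ih ε ?_ γ (hγ.mono fun l hl => ?_) φ
    · simp only [Pi.add_apply, Finset.sum_add_distrib, Finset.sum_pi_single', Finset.mem_univ,
        if_true] at hd
      simpa [Pi.single_apply] using hd
    · simp only [Pi.add_apply] at hl ⊢
      omega

/-- Induction on the remaining generations, with γ collecting the leading indices already used.
Keeping w^(α-γ) on the test function avoids any functional with dependent columns. -/
theorem descendantSum_eq (h : IsReciprocalSystem Ξ W T) (hcol : ∀ j, Ξ.col j ≠ 0)
    {ν : (Fin n → ℕ) → Fin n → ℝ}
    (hν : ∀ α, s < (supp α).card → IsRelation Ξ α (ν α) ∧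
      ∃ m, IsLead (ν α) m ∧ ∀ u, IsRelation Ξ α u → ∀ i, i < m → u i = 0) (r : ℕ) :
    ∀ (k : ℕ) (c : ℝ) (α γ : Fin n → ℕ), k + r + s = n → IsNode Ξ k α → γ ≤ α →
      (∀ i, γ i ≠ 0 → ∀ u, IsRelation Ξ α u → ∀ l, l < i → u l = 0) →
      ∀ φ, descendantSum ν T (W (α - γ) φ) r (c, α) = c * T γ φ := by
  induction r with
  | zero =>
    intro k c α γ hk hα hγα _ φ
    have hcard : (supp α).card = s := by
      have := hα.card
      omega
    have hind := isIndep_of_det_ne_zero hcard (hα.det_ne_zero hcard)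
    have heq : γ + (α - γ) = α := add_tsub_cancel_of_le hγα
    have := h.cancel_add (α - γ) γ (by rwa [heq]) φ
    rw [heq] at this
    rw [descendantSum, this]
  | succ r ih =>
    intro k c α γ hk hα hγα hγ φ
    obtain ⟨hrel, m, hm, hmin⟩ := hν α (by have := hα.card; omega)
    rw [descendantSum, sum_children ν (c, α) hm]
    set γ' := γ + Pi.single m 1 with hγ'
    have hterm : ∀ j ∈ Finset.univ.filter (fun j => m < j ∧ ν α j ≠ 0),
        descendantSum ν T (W (α - γ) φ) r (-c * (ν α j / ν α m), shift m j α) =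
          (-c * (ν α j / ν α m) : ℝ) * T γ' (W (Pi.single j 1) φ) := by
      intro j hj
      obtain ⟨hmj, hνj⟩ := (Finset.mem_filter.1 hj).2
      obtain ⟨hαj, hαm, hzero, hnode⟩ := hα.shift hrel hm hmin hmj hνj
      have hγj : γ j = 0 := by
        by_contra h0
        exact hm.1 (hγ j h0 _ hrel m hmj)
      have hle : γ' ≤ shift m j α := by
        intro i
        have := hγα i
        by_cases him : i = m
        · subst him
          simpa [hγ', shift] using this
        · by_cases hij : i = j
          · subst hij
            simp [hγ', him, hγj]
          · simpa [hγ', shift, him, hij] using this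
      -- Both α and γ gain one at m, so the leftover monomial loses exactly the factor w(j).
      have hsplit : α - γ = (shift m j α - γ') + Pi.single j 1 := by
        funext i
        by_cases him : i = m
        · subst him
          simp [hγ', shift, hmj.ne]
        · by_cases hij : i = j
          · subst hij
            simp [hγ', shift, him, hγj, hαj]
          · simp [hγ', shift, him, hij]
      rw [hsplit, h.mul_add]
      refine ih (k + 1) _ _ γ' (by omega) hnode hle (fun i hi u hu l hl => ?_) _
      have hu' := hu.mono fun i hi => (hzero i).2 (Or.inl hi)
      by_cases him : i = m
      · exact hmin u hu' l (him ▸ hl)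
      · exact hγ i (by simpa [hγ', him] using hi) u hu' l hl
    rw [Finset.sum_congr rfl hterm]
    -- The comparison is with α raised at m, because γ' ≤ α may fail there; the support is that of
    -- α.
    have hind : IsIndep Ξ γ' := by
      intro v hv
      refine hv.eq_zero_of_forall_lt (α := α + Pi.single m 1) hcol
        (fun i => Nat.add_le_add_right (hγα i) _) fun i hi u hu l hl => ?_
      have hu' : IsRelation Ξ α u := by
        refine hu.mono fun i hi => ?_
        by_cases him : i = m
        · exact absurd (hrel.2 m (him ▸ hi)) hm.1
        · simpa [him] using hi
      by_cases him : i = m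
      · exact hmin u hu' l (him ▸ hl)
      · exact hγ i (by simpa [hγ', him] using hi) u hu' l hl
    have hlin := h.isLinearMap γ' hind
    have hsum : ∑ j with m < j ∧ ν α j ≠ 0, (ν α j : ℂ) • W (Pi.single j 1) φ =
        -((ν α m : ℂ) • W (Pi.single m 1) φ) := by
      rw [eq_neg_iff_add_eq_zero, ← h.sum_eq_zero _ hrel.1 φ, add_comm,
        ← Finset.add_sum_erase _ _ (Finset.mem_univ m)]
      congr 1
      refine Finset.sum_subset (fun j hj => ?_) fun j hj hj' => ?_
      · exact Finset.mem_erase.2 ⟨(Finset.mem_filter.1 hj).2.1.ne', Finset.mem_univ j⟩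
      · have hνj : ν α j = 0 := by
          rcases lt_or_gt_of_ne (Finset.mem_erase.1 hj).1 with hlt | hlt
          · exact hm.2 j hlt
          · by_contra hne
            exact hj' (Finset.mem_filter.2 ⟨Finset.mem_univ j, hlt, hne⟩)
        rw [hνj, Complex.ofReal_zero, zero_smul]
    have hm0 : (ν α m : ℂ) ≠ 0 := Complex.ofReal_ne_zero.2 hm.1
    calc ∑ j with m < j ∧ ν α j ≠ 0,
          ((-c * (ν α j / ν α m) : ℝ) : ℂ) * T γ' (W (Pi.single j 1) φ)
        = (-c / ν α m : ℂ) * ∑ j with m < j ∧ ν α j ≠ 0,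
            (ν α j : ℂ) * T γ' (W (Pi.single j 1) φ) := by
          rw [Finset.mul_sum]
          refine Finset.sum_congr rfl fun j _ => ?_
          push_cast
          ring
      _ = (-c / ν α m : ℂ) * T γ' (-((ν α m : ℂ) • W (Pi.single m 1) φ)) := by
          have := map_sum (hlin.mk' (T γ')) (fun j => (ν α j : ℂ) • W (Pi.single j 1) φ)
            (Finset.univ.filter fun j => m < j ∧ ν α j ≠ 0)
          simp only [map_smul, IsLinearMap.mk'_apply, smul_eq_mul] at this
          rw [← this, hsum]
      _ = c * T γ φ := by
          rw [hlin.map_neg, hlin.map_smul, h.cancel γ m φ hind, smul_eq_mul]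
          field_simp

end IsReciprocalSystem

theorem isNode_of_mem_P (hrank : Ξ.rank = s) {ν : (Fin n → ℕ) → Fin n → ℝ}
    (hν : ∀ α, s < (supp α).card → IsRelation Ξ α (ν α) ∧
      ∃ m, IsLead (ν α) m ∧ ∀ u, IsRelation Ξ α u → ∀ i, i < m → u i = 0) (k : ℕ) :
    k + s ≤ n → ∀ a ∈ P ν k, IsNode Ξ k a.2 := by
  induction k with
  | zero =>
    intro _ a ha
    rw [P, Multiset.mem_singleton] at ha
    subst ha
    exact isNode_one hrank
  | succ k ih =>
    intro hk a ha
    rw [P, Multiset.mem_bind] at ha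
    obtain ⟨b, hb, ha⟩ := ha
    have hnode := ih (by omega) b hb
    obtain ⟨m, j, hm, hmj, hνj, hab⟩ := mem_children ha
    obtain ⟨hrel, m', hm', hmin⟩ := hν b.2 (by have := hnode.card; omega)
    rw [hab]
    exact (hnode.shift hrel hm (hm.unique hm' ▸ hmin) hmj hνj).2.2.2

/-- The partial fraction decomposition `1 / w^(1,…,1) = ∑ c / w^α` over `(c, α) ∈ P_{n-s}`. -/
theorem IsReciprocalSystem.sum_P {X : Type*} [AddCommGroup X] [Module ℂ X]
    {W : (Fin n → ℕ) → X →ₗ[ℂ] X} {T : (Fin n → ℕ) → X → ℂ} (h : IsReciprocalSystem Ξ W T)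
    (hrank : Ξ.rank = s) (hcol : ∀ j, Ξ.col j ≠ 0) {ν : (Fin n → ℕ) → Fin n → ℝ}
    (hν : ∀ α, s < (supp α).card → IsRelation Ξ α (ν α) ∧
      ∃ m, IsLead (ν α) m ∧ ∀ u, IsRelation Ξ α u → ∀ i, i < m → u i = 0) (φ : X) :
    ((P ν (n - s)).map fun a => (a.1 : ℂ) * T a.2 (W (fun _ => 1) φ)).sum = T 0 φ := by
  have hsn : s ≤ n := by
    rw [← hrank]
    simpa using Ξ.rank_le_width
  have h1 := sum_P_add ν T (W (fun _ => 1) φ) (n - s) 0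
  -- At γ = 0 the condition on the support of γ is vacuous and the leftover monomial is the whole
  -- product.
  have h2 := h.descendantSum_eq hcol hν (n - s) 0 1 (fun _ => 1) 0 (by omega)
    (isNode_one hrank) (fun _ => Nat.zero_le _) (fun i hi => absurd rfl hi) φ
  rw [zero_add] at h1
  rw [tsub_zero] at h2
  rw [P, Multiset.map_singleton, Multiset.sum_singleton, h2] at h1
  simpa [descendantSum] using h1

end Recursion

/-! ### Signed powers on the line -/

section OneDimensional

theorem measurable_realSign : Measurable Real.sign := by
  unfold Real.sign
  exact Measurable.ite measurableSet_Iio measurable_const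
    (Measurable.ite measurableSet_Ioi measurable_const measurable_const)

theorem abs_realSign_le (u : ℝ) : |Real.sign u| ≤ 1 := by
  rcases Real.sign_apply_eq u with h | h | h <;> simp [h]

theorem integrable_sign_mul {f : ℝ → ℂ} (hf : Integrable f) :
    Integrable fun u => (Real.sign u : ℂ) * f u := by
  refine hf.bdd_mul (c := 1) ?_ (Filter.Eventually.of_forall fun u => ?_)
  · exact (Complex.measurable_ofReal.comp measurable_realSign).aestronglyMeasurable
  · rw [Complex.norm_real, Real.norm_eq_abs]
    exact abs_realSign_le u

theorem integral_sign_mul_deriv {v v' : ℝ → ℂ} (hv : ∀ u, HasDerivAt v (v' u) u)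
    (hi : Integrable v) (hi' : Integrable v') :
    ∫ u, (Real.sign u : ℂ) * v' u = -(2 * v 0) := by
  have hs := integrable_sign_mul hi'
  rw [← intervalIntegral.integral_Iic_add_Ioi (b := 0) hs.integrableOn hs.integrableOn,
    integral_Iic_eq_integral_Iio]
  have h1 : ∫ u in Set.Iio (0 : ℝ), (Real.sign u : ℂ) * v' u = -v 0 := by
    rw [setIntegral_congr_fun (g := fun u => -v' u) measurableSet_Iio fun u hu => by
      simp [Real.sign_of_neg hu], integral_neg, ← integral_Iic_eq_integral_Iio,
      integral_Iic_of_hasDerivAt_of_tendsto' (fun u _ => hv u) hi'.integrableOn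
        (tendsto_zero_of_hasDerivAt_of_integrableOn_Iic (a := 0) (fun u _ => hv u)
          hi'.integrableOn hi.integrableOn), sub_zero]
  have h2 : ∫ u in Set.Ioi (0 : ℝ), (Real.sign u : ℂ) * v' u = -v 0 := by
    rw [setIntegral_congr_fun (g := v') measurableSet_Ioi fun u hu => by
      simp [Real.sign_of_pos hu],
      integral_Ioi_of_hasDerivAt_of_tendsto' (fun u _ => hv u) hi'.integrableOn
        (tendsto_zero_of_hasDerivAt_of_integrableOn_Ioi (a := 0) (fun u _ => hv u)
          hi'.integrableOn hi.integrableOn), zero_sub]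
  rw [h1, h2]
  ring

/-- The kernels with `d/du kern (k + 1) = kern k`, where `kern 0` stands for a point mass. -/
noncomputable def kern : ℕ → ℝ → ℝ
  | 0, _ => 1
  | k + 1, u => sgnPow u k / (k.factorial : ℝ)

/-- The reference measure of `kern k`. -/
noncomputable def kernMeasure : ℕ → Measure ℝ
  | 0 => Measure.dirac 0
  | _ + 1 => volume

instance sigmaFinite_kernMeasure (k : ℕ) : SigmaFinite (kernMeasure k) := by
  cases k <;> (unfold kernMeasure; infer_instance)

theorem measurable_sgnPow (k : ℕ) : Measurable fun u => sgnPow u k := by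
  unfold sgnPow
  exact (measurable_realSign.mul (measurable_id.pow_const k)).div_const 2

theorem measurable_kern (k : ℕ) : Measurable (kern k) := by
  cases k with
  | zero => exact measurable_const
  | succ k => exact (measurable_sgnPow k).div_const _

theorem abs_sgnPow_le (u : ℝ) (k : ℕ) : |sgnPow u k| ≤ |u| ^ k := by
  rw [sgnPow, abs_div, abs_mul, abs_pow, abs_of_pos (zero_lt_two' ℝ)]
  have h1 := abs_realSign_le u
  have h2 : 0 ≤ |u| ^ k := by positivity
  nlinarith

theorem abs_kern_le (k : ℕ) (u : ℝ) : |kern k u| ≤ (1 + |u|) ^ k := by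
  cases k with
  | zero => simp [kern]
  | succ k =>
    rw [kern, abs_div, Nat.abs_cast]
    calc |sgnPow u k| / (k.factorial : ℝ) ≤ |sgnPow u k| :=
          div_le_self (abs_nonneg _) (by exact_mod_cast k.factorial_pos)
      _ ≤ |u| ^ k := abs_sgnPow_le u k
      _ ≤ (1 + |u|) ^ k := by gcongr; linarith [abs_nonneg u]
      _ ≤ (1 + |u|) ^ (k + 1) := pow_le_pow_right₀ (by linarith [abs_nonneg u]) (Nat.le_succ k)

theorem integrable_pow_mul_schwartz (f : 𝓢(ℝ, ℂ)) (k : ℕ) :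
    Integrable fun u : ℝ => (u : ℂ) ^ k * f u := by
  refine (integrable_norm_iff ?_).1 ?_
  · exact (((Complex.continuous_ofReal.pow k).mul f.continuous)).aestronglyMeasurable
  · simpa using f.integrable_pow_mul volume k

/-- The weak form of `kern (k + 1)' = kern k`. For k = 0 the unit jump of sgn/2 produces the point
mass; for larger k, u^k f vanishes at 0, so there is no boundary term. -/
theorem integral_kern_succ_mul_deriv (f : 𝓢(ℝ, ℂ)) (k : ℕ) :
    ∫ u, (kern (k + 1) u : ℂ) * -deriv f u ∂(kernMeasure (k + 1)) =
      ∫ u, (kern k u : ℂ) * f u ∂(kernMeasure k) := by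
  have hderiv : ∀ j : ℕ, Integrable fun u : ℝ => (u : ℂ) ^ j * deriv f u := fun j => by
    simpa using integrable_pow_mul_schwartz (SchwartzMap.derivCLM ℂ ℂ f) j
  cases k with
  | zero =>
    have h := integral_sign_mul_deriv (fun u => f.hasDerivAt u) f.integrable
      (by simpa using hderiv 0)
    simp only [kern, kernMeasure, integral_dirac, sgnPow]
    calc ∫ u : ℝ, (((Real.sign u * u ^ 0 / 2 / (Nat.factorial 0 : ℝ) : ℝ)) : ℂ) * -deriv f u
        = ∫ u : ℝ, (-1 / 2 : ℂ) * ((Real.sign u : ℂ) * deriv f u) := by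
          refine integral_congr_ae (Filter.Eventually.of_forall fun u => ?_)
          push_cast
          simp
          ring
      _ = _ := by
          rw [integral_const_mul, h]
          push_cast
          ring
  | succ k =>
    have hv : ∀ u : ℝ, HasDerivAt (fun u : ℝ => (u : ℂ) ^ (k + 1) * f u)
        ((k + 1 : ℂ) * ((u : ℂ) ^ k * f u) + (u : ℂ) ^ (k + 1) * deriv f u) u := by
      intro u
      have h1 : HasDerivAt (fun u : ℝ => (u : ℂ) ^ (k + 1)) ((k + 1 : ℂ) * (u : ℂ) ^ k) u := by
        simpa using (Complex.ofRealCLM.hasDerivAt (x := u)).fun_pow (k + 1)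
      have := h1.mul (f.hasDerivAt u)
      rw [mul_assoc] at this
      exact this
    have hi := integrable_pow_mul_schwartz f
    have h := integral_sign_mul_deriv hv (hi (k + 1))
      (((hi k).const_mul _).add (hderiv (k + 1)))
    simp only [mul_add] at h
    rw [integral_add (by simpa using integrable_sign_mul ((hi k).const_mul (k + 1 : ℂ)))
      (integrable_sign_mul (hderiv (k + 1)))] at h
    simp only [Complex.ofReal_zero, zero_pow (Nat.succ_ne_zero k), zero_mul, mul_zero,
      neg_zero] at h
    have hfac : ((k.factorial : ℝ) : ℂ) ≠ 0 := by
      exact_mod_cast k.factorial_ne_zero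
    have hk : (k + 1 : ℂ) ≠ 0 := by exact_mod_cast k.succ_ne_zero
    simp only [kern, kernMeasure, sgnPow]
    have e1 : ∀ u : ℝ, (((Real.sign u * u ^ (k + 1) / 2 / ((k + 1).factorial : ℝ) : ℝ)) : ℂ) *
        -deriv f u = (-1 / (2 * ((k + 1 : ℂ) * (k.factorial : ℝ)))) *
          ((Real.sign u : ℂ) * ((u : ℂ) ^ (k + 1) * deriv f u)) := by
      intro u
      rw [Nat.factorial_succ]
      push_cast
      field_simp
    have e2 : ∀ u : ℝ, (((Real.sign u * u ^ k / 2 / (k.factorial : ℝ) : ℝ)) : ℂ) * f u =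
        (1 / (2 * ((k + 1 : ℂ) * (k.factorial : ℝ)))) *
          ((Real.sign u : ℂ) * ((k + 1 : ℂ) * ((u : ℂ) ^ k * f u))) := by
      intro u
      push_cast
      field_simp
    simp_rw [e1, e2, integral_const_mul]
    rw [eq_neg_of_add_eq_zero_left h]
    ring

theorem integrable_inv_one_add_sq_kernMeasure (k : ℕ) :
    Integrable (fun u : ℝ => (1 + u ^ 2)⁻¹) (kernMeasure k) := by
  cases k with
  | zero => exact integrable_dirac (by simp)
  | succ k => exact integrable_inv_one_add_sq

theorem ae_kernMeasure (k : ℕ) : ∀ᵐ u ∂kernMeasure k, k = 0 → u = 0 := by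
  cases k with
  | zero =>
    rw [kernMeasure, ae_dirac_eq]
    simp
  | succ k => simp

end OneDimensional

/-! ### Kernel integrals along the columns and their convergence -/

section PiIntegral

variable {s n : ℕ} {Ξ : Matrix (Fin s) (Fin n) ℝ}

/-- The inverse Fourier transform of `1 / w^γ`: the integral of `f` against the convolution of
the kernels `kern (γ i)` along the columns of `Ξ`. -/
noncomputable def kernIntegral (Ξ : Matrix (Fin s) (Fin n) ℝ) (γ : Fin n → ℕ)
    (f : EuclideanSpace ℝ (Fin s) → ℂ) : ℂ :=
  ∫ t, ((∏ i, kern (γ i) (t i) : ℝ) : ℂ) * f (WithLp.toLp 2 (Ξ *ᵥ t))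
    ∂(Measure.pi fun i => kernMeasure (γ i))

/-- An injective linear map on a finite-dimensional space is bounded below. Requiring C ≥ 1 lets 1 +
|t i| be bounded by C (1 + ‖Ξ t‖). -/
theorem IsIndep.exists_abs_le {γ : Fin n → ℕ} (h : IsIndep Ξ γ) :
    ∃ C : ℝ, 1 ≤ C ∧ ∀ t : Fin n → ℝ, (∀ i, γ i = 0 → t i = 0) →
      ∀ i, |t i| ≤ C * ‖(WithLp.toLp 2 (Ξ *ᵥ t) : EuclideanSpace ℝ (Fin s))‖ := by
  let V : Submodule ℝ (Fin n → ℝ) :=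
    { carrier := {t | ∀ i, γ i = 0 → t i = 0}
      add_mem' := fun {a b} ha hb i hi => by simp [ha i hi, hb i hi]
      zero_mem' := fun i _ => rfl
      smul_mem' := fun c a ha i hi => by simp [ha i hi] }
  let L : V →ₗ[ℝ] EuclideanSpace ℝ (Fin s) :=
    ((WithLp.linearEquiv 2 ℝ (Fin s → ℝ)).symm.toLinearMap ∘ₗ Ξ.mulVecLin) ∘ₗ V.subtype
  have hL : LinearMap.ker L = ⊥ := by
    rw [LinearMap.ker_eq_bot']
    rintro ⟨t, ht⟩ h0
    have : Ξ *ᵥ t = 0 := congrArg WithLp.ofLp h0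
    exact Subtype.ext (h t ⟨this, ht⟩)
  obtain ⟨c, _, hc⟩ := L.exists_antilipschitzWith hL
  refine ⟨max 1 c, le_max_left _ _, fun t ht i => ?_⟩
  have h1 := hc.le_mul_dist ⟨t, ht⟩ 0
  rw [map_zero, dist_zero_right, dist_zero_right] at h1
  calc |t i| ≤ ‖t‖ := norm_le_pi_norm t i
    _ ≤ c * ‖(WithLp.toLp 2 (Ξ *ᵥ t) : EuclideanSpace ℝ (Fin s))‖ := h1
    _ ≤ _ := by gcongr; exact le_max_right _ _

theorem measurable_kernIntegrand (γ : Fin n → ℕ) (f : 𝓢(EuclideanSpace ℝ (Fin s), ℂ)) :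
    Measurable fun t : Fin n → ℝ =>
      ((∏ i, kern (γ i) (t i) : ℝ) : ℂ) * f (WithLp.toLp 2 (Ξ *ᵥ t)) := by
  refine Measurable.mul (Complex.measurable_ofReal.comp ?_) (f.continuous.comp ?_).measurable
  · exact Finset.measurable_prod _ fun i _ => (measurable_kern _).comp (measurable_pi_apply i)
  · exact (PiLp.continuous_toLp 2 _).comp (continuous_const.matrix_mulVec continuous_id)

theorem IsIndep.integrable {γ : Fin n → ℕ} (h : IsIndep Ξ γ)
    (f : 𝓢(EuclideanSpace ℝ (Fin s), ℂ)) :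
    Integrable (fun t : Fin n → ℝ =>
      ((∏ i, kern (γ i) (t i) : ℝ) : ℂ) * f (WithLp.toLp 2 (Ξ *ᵥ t)))
      (Measure.pi fun i => kernMeasure (γ i)) := by
  obtain ⟨C, hC1, hC⟩ := h.exists_abs_le
  -- In each coordinate, γ i powers absorb the growth of the kernel and two more pay for the
  -- integrable weight (1 + t²)⁻¹.
  set M := ∑ i, (γ i + 2) with hM
  obtain ⟨B, hB⟩ : ∃ B, ∀ x, (1 + ‖x‖) ^ M * ‖f x‖ ≤ B :=
    ⟨_, fun x => by
      simpa using SchwartzMap.one_add_le_sup_seminorm_apply (𝕜 := ℂ) (m := (M, 0)) le_rfl le_rfl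
        f x⟩
  have hprod : Integrable (fun t : Fin n → ℝ => ∏ i, (1 + t i ^ 2)⁻¹)
      (Measure.pi fun i => kernMeasure (γ i)) :=
    Integrable.fintype_prod fun i => integrable_inv_one_add_sq_kernMeasure (γ i)
  refine (hprod.const_mul (C ^ M * B)).mono' (measurable_kernIntegrand γ f).aestronglyMeasurable ?_
  have hae : ∀ᵐ t ∂(Measure.pi fun i => kernMeasure (γ i)), ∀ i, γ i = 0 → t i = 0 :=
    ae_all_iff.2 fun i =>
      (Measure.quasiMeasurePreserving_eval (fun i => kernMeasure (γ i)) i).ae (ae_kernMeasure (γ i))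
  filter_upwards [hae] with t ht
  set x : EuclideanSpace ℝ (Fin s) := WithLp.toLp 2 (Ξ *ᵥ t)
  rw [norm_mul, Complex.norm_real, Real.norm_eq_abs, Finset.abs_prod, Finset.prod_inv_distrib,
    ← div_eq_mul_inv, le_div_iff₀ (Finset.prod_pos fun i _ => by positivity)]
  have hle : (∏ i, |kern (γ i) (t i)|) * ∏ i, (1 + t i ^ 2) ≤ (C * (1 + ‖x‖)) ^ M := by
    rw [← Finset.prod_mul_distrib, hM, ← Finset.prod_pow_eq_pow_sum]
    refine Finset.prod_le_prod (fun i _ => by positivity) fun i _ => ?_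
    have hi : 1 + |t i| ≤ C * (1 + ‖x‖) := by
      have := hC t ht i
      linarith
    calc |kern (γ i) (t i)| * (1 + t i ^ 2) ≤ (1 + |t i|) ^ γ i * (1 + |t i|) ^ 2 := by
          refine mul_le_mul (abs_kern_le _ _) ?_ (by positivity) (by positivity)
          nlinarith [sq_abs (t i), abs_nonneg (t i)]
      _ = (1 + |t i|) ^ (γ i + 2) := (pow_add _ _ _).symm
      _ ≤ _ := by gcongr
  calc (∏ i, |kern (γ i) (t i)|) * ‖f x‖ * ∏ i, (1 + t i ^ 2)
      = ((∏ i, |kern (γ i) (t i)|) * ∏ i, (1 + t i ^ 2)) * ‖f x‖ := by ring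
    _ ≤ (C * (1 + ‖x‖)) ^ M * ‖f x‖ := by gcongr
    _ = C ^ M * ((1 + ‖x‖) ^ M * ‖f x‖) := by rw [mul_pow, mul_assoc]
    _ ≤ C ^ M * B := by gcongr; exact hB x

end PiIntegral

/-! ### Lowering the order of a kernel by differentiation -/

section Cancel

open LineDeriv

variable {s n : ℕ} {Ξ : Matrix (Fin s) (Fin n) ℝ}

theorem integral_pi_eq_integral_insertNth {N : ℕ} (μ : Fin (N + 1) → Measure ℝ)
    [∀ i, SigmaFinite (μ i)] (i : Fin (N + 1)) {F : (Fin (N + 1) → ℝ) → ℂ}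
    (hF : Integrable F (Measure.pi μ)) :
    ∫ t, F t ∂(Measure.pi μ) =
      ∫ t', ∫ u, F (i.insertNth u t') ∂(μ i) ∂(Measure.pi fun j => μ (i.succAbove j)) := by
  have hmp := (measurePreserving_piFinSuccAbove μ i).symm
  have hF' := (hmp.integrable_comp_emb (MeasurableEquiv.measurableEmbedding _)).2 hF
  rw [← hmp.integral_comp']
  exact integral_prod_symm _ hF'

/-- The restriction of a Schwartz function to the line through `p` with direction `ξ`. -/
theorem exists_schwartzMap_line {E : Type*} [NormedAddCommGroup E] [NormedSpace ℝ E]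
    (f : 𝓢(E, ℂ)) (p : E) {ξ : E} (hξ : ξ ≠ 0) :
    ∃ h : 𝓢(ℝ, ℂ), (∀ u, h u = f (u • ξ + p)) ∧ ∀ u, deriv h u = (∂_{ξ} f) (u • ξ + p) := by
  have htemp : Function.HasTemperateGrowth fun u : ℝ => u • ξ + p :=
    ((ContinuousLinearMap.toSpanSingleton ℝ ξ).hasTemperateGrowth).add (.const p)
  have hanti : AntilipschitzWith ‖ξ‖₊⁻¹ fun u : ℝ => u • ξ + p := by
    refine AntilipschitzWith.of_le_mul_dist fun u v => ?_
    have h0 : ‖ξ‖ ≠ 0 := norm_ne_zero_iff.2 hξ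
    rw [dist_add_right, dist_eq_norm, dist_eq_norm, ← sub_smul, norm_smul, NNReal.coe_inv,
      coe_nnnorm]
    field_simp
    exact le_rfl
  refine ⟨SchwartzMap.compCLMOfAntilipschitz ℂ htemp hanti f, fun u => rfl, fun u => ?_⟩
  have h1 : HasDerivAt (fun u : ℝ => u • ξ + p) ξ u := by
    simpa using ((hasDerivAt_id u).smul_const ξ).add_const p
  rw [SchwartzMap.lineDerivOp_apply_eq_fderiv]
  exact ((f.hasFDerivAt _).comp_hasDerivAt u h1).deriv

theorem toLp_mulVec_insertNth {N : ℕ} (Ξ : Matrix (Fin s) (Fin (N + 1)) ℝ) (i : Fin (N + 1))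
    (u : ℝ) (t : Fin N → ℝ) :
    (WithLp.toLp 2 (Ξ *ᵥ i.insertNth u t) : EuclideanSpace ℝ (Fin s)) =
      u • WithLp.toLp 2 (Ξ.col i) + WithLp.toLp 2 (Ξ *ᵥ i.insertNth 0 t) := by
  ext a
  simp [Matrix.mulVec, dotProduct, Fin.sum_univ_succAbove _ i, mul_comm]

theorem IsIndep.col_ne_zero {γ : Fin n → ℕ} (h : IsIndep Ξ γ) {i : Fin n} (hi : γ i ≠ 0) :
    Ξ.col i ≠ 0 := by
  intro h0
  have := h (Pi.single i 1) ⟨by simpa using h0, fun l hl => by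
    rw [Pi.single_eq_of_ne]
    rintro rfl
    exact hi hl⟩
  simpa using congrFun this i

/-- Differentiation along a column lowers the order of the corresponding kernel. -/
theorem kernIntegral_add_single (γ : Fin n → ℕ) (i : Fin n)
    (h : IsIndep Ξ (γ + Pi.single i 1)) (f : 𝓢(EuclideanSpace ℝ (Fin s), ℂ)) :
    kernIntegral Ξ (γ + Pi.single i 1)
        (-∂_{(WithLp.toLp 2 (Ξ.col i) : EuclideanSpace ℝ (Fin s))} f : 𝓢(_, ℂ)) =
      kernIntegral Ξ γ f := by
  cases n with
  | zero => exact i.elim0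
  | succ N =>
    have h' : IsIndep Ξ γ := h.mono fun l hl => by
      simp only [Pi.add_apply] at hl
      omega
    have hξ : (WithLp.toLp 2 (Ξ.col i) : EuclideanSpace ℝ (Fin s)) ≠ 0 := fun h0 =>
      h.col_ne_zero (i := i) (by simp) (congrArg WithLp.ofLp h0)
    rw [kernIntegral, kernIntegral, integral_pi_eq_integral_insertNth _ i (h.integrable _),
      integral_pi_eq_integral_insertNth _ i (h'.integrable _)]
    have hs : ∀ l, (γ + Pi.single i 1 : Fin (N + 1) → ℕ) (i.succAbove l) =
        γ (i.succAbove l) := fun l => by simp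
    have hi : (γ + Pi.single i 1 : Fin (N + 1) → ℕ) i = γ i + 1 := by simp
    simp only [hs, hi, Fin.prod_univ_succAbove _ i, Fin.insertNth_apply_same,
      Fin.insertNth_apply_succAbove]
    refine integral_congr_ae (Filter.Eventually.of_forall fun t => ?_)
    -- With the other coordinates frozen, the inner integral is the one-variable identity on a line
    -- in direction ξ_i.
    obtain ⟨g, hg, hg'⟩ := exists_schwartzMap_line f (WithLp.toLp 2 (Ξ *ᵥ i.insertNth 0 t)) hξ
    have key := congrArg (fun z => ((∏ l, kern (γ (i.succAbove l)) (t l) : ℝ) : ℂ) * z)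
      (integral_kern_succ_mul_deriv g (γ i))
    simp only [← integral_const_mul] at key
    refine Eq.trans (integral_congr_ae (.of_forall fun u => ?_))
      (key.trans (integral_congr_ae (.of_forall fun u => ?_)))
    · dsimp only
      rw [toLp_mulVec_insertNth, hg', neg_apply]
      push_cast
      ring
    · dsimp only
      rw [toLp_mulVec_insertNth, hg]
      push_cast
      ring

theorem kernIntegral_zero (f : EuclideanSpace ℝ (Fin s) → ℂ) : kernIntegral Ξ 0 f = f 0 := by
  have hpi : Measure.pi (fun _ : Fin n => (Measure.dirac (0 : ℝ))) = Measure.dirac 0 := by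
    refine Measure.pi_eq fun B hB => ?_
    rw [Measure.dirac_apply' _ (MeasurableSet.univ_pi hB)]
    simp only [Measure.dirac_apply' _ (hB _)]
    by_cases h : ∀ i, (0 : ℝ) ∈ B i
    · rw [Set.indicator_of_mem (by simpa using h)]
      simp [h]
    · push Not at h
      obtain ⟨i, hi⟩ := h
      rw [Set.indicator_of_notMem fun h0 : (0 : Fin n → ℝ) ∈ Set.univ.pi B => hi (h0 i trivial),
        Finset.prod_eq_zero (Finset.mem_univ i) (Set.indicator_of_notMem hi _)]
  simp [kernIntegral, kernMeasure, hpi, kern]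

end Cancel

/-! ### Multi-indices with s nonzero entries: the summands of the Green's function -/

section FullSupport

variable {s n : ℕ} {Ξ : Matrix (Fin s) (Fin n) ℝ}

/-- The extension by zero of a vector indexed by the nonzero entries of `α`. -/
noncomputable def extendZero {s n : ℕ} (α : Fin n → ℕ) (hα : (supp α).card = s)
    (t : Fin s → ℝ) : Fin n → ℝ :=
  Function.extend (sigma α hα) t (0 : Fin n → ℝ)

theorem extendZero_sigma {α : Fin n → ℕ} (hα : (supp α).card = s) (t : Fin s → ℝ) (a : Fin s) :
    extendZero α hα t (sigma α hα a) = t a :=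
  (sigma α hα).injective.extend_apply t _ a

theorem extendZero_of_eq_zero {α : Fin n → ℕ} (hα : (supp α).card = s) (t : Fin s → ℝ)
    {i : Fin n} (hi : α i = 0) : extendZero α hα t i = 0 :=
  Function.extend_apply' t _ i fun h => (mem_range_sigma hα).1 h hi

theorem prod_eq_prod_sigma {M : Type*} [CommMonoid M] {α : Fin n → ℕ} (hα : (supp α).card = s)
    (f : Fin n → M) (hf : ∀ i, α i = 0 → f i = 1) : ∏ i, f i = ∏ a, f (sigma α hα a) := by
  rw [← Finset.prod_image (s := Finset.univ) (g := sigma α hα) (f := f)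
    (fun _ _ _ _ hab => (sigma α hα).injective hab)]
  refine (Finset.prod_subset (Finset.subset_univ _) fun i _ hi => hf i ?_).symm
  by_contra hne
  obtain ⟨b, hb⟩ := (mem_range_sigma hα).2 hne
  exact hi (Finset.mem_image.2 ⟨b, Finset.mem_univ _, hb⟩)

theorem measurable_extendZero {α : Fin n → ℕ} (hα : (supp α).card = s) :
    Measurable (extendZero α hα) := by
  refine measurable_pi_iff.2 fun i => ?_
  by_cases hi : α i = 0
  · simp only [extendZero_of_eq_zero hα _ hi]
    exact measurable_const
  · obtain ⟨a, rfl⟩ := (mem_range_sigma hα).2 hi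
    simp only [extendZero_sigma]
    exact measurable_pi_apply a

/-- Point masses pin the coordinates off the support at 0 and leave Lebesgue measure on the rest.
Boxes decide equality; one whose side off the support misses 0 is null for both measures. -/
theorem pi_kernMeasure_eq_map {α : Fin n → ℕ} (hα : (supp α).card = s) :
    Measure.pi (fun i => kernMeasure (α i)) = Measure.map (extendZero α hα) volume := by
  have hvol : ∀ {k : ℕ}, k ≠ 0 → kernMeasure k = volume := fun {k} hk => by
    obtain ⟨l, rfl⟩ := Nat.exists_eq_succ_of_ne_zero hk
    rfl
  have hdirac : ∀ {k : ℕ}, k = 0 → kernMeasure k = Measure.dirac 0 := fun {k} hk => by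
    subst hk
    rfl
  refine Measure.pi_eq fun B hB => ?_
  rw [Measure.map_apply (measurable_extendZero hα) (MeasurableSet.univ_pi hB)]
  by_cases h : ∀ i, α i = 0 → (0 : ℝ) ∈ B i
  · have hpre : extendZero α hα ⁻¹' Set.univ.pi B =
        Set.univ.pi fun a => B (sigma α hα a) := by
      ext t
      simp only [Set.mem_preimage, Set.mem_univ_pi]
      refine ⟨fun ht a => extendZero_sigma hα t a ▸ ht _, fun ht i => ?_⟩
      by_cases hi : α i = 0
      · rw [extendZero_of_eq_zero hα t hi]
        exact h i hi
      · obtain ⟨a, rfl⟩ := (mem_range_sigma hα).2 hi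
        rw [extendZero_sigma]
        exact ht a
    rw [hpre, volume_pi_pi, prod_eq_prod_sigma hα]
    · refine Finset.prod_congr rfl fun a _ => ?_
      rw [hvol ((mem_range_sigma hα).1 ⟨a, rfl⟩)]
    · intro i hi
      rw [hdirac hi, Measure.dirac_apply_of_mem (h i hi)]
  · push Not at h
    obtain ⟨i, hi, hBi⟩ := h
    have hpre : extendZero α hα ⁻¹' Set.univ.pi B = ∅ := by
      refine Set.eq_empty_of_forall_notMem fun t ht => hBi ?_
      rw [← extendZero_of_eq_zero hα t hi]
      exact ht i trivial
    rw [hpre, measure_empty, Finset.prod_eq_zero (Finset.mem_univ i)]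
    rw [hdirac hi, Measure.dirac_apply' _ (hB i), Set.indicator_of_notMem hBi]

theorem mulVec_extendZero {α : Fin n → ℕ} (hα : (supp α).card = s) (t : Fin s → ℝ) :
    Ξ *ᵥ extendZero α hα t = subMatrix Ξ α hα *ᵥ t := by
  funext a
  change ∑ i, Ξ a i * extendZero α hα t i = ∑ b, Ξ a (sigma α hα b) * t b
  have h0 : ∀ i, i ∉ Finset.univ.image (sigma α hα) → Ξ a i * extendZero α hα t i = 0 := by
    intro i hi
    rw [extendZero_of_eq_zero, mul_zero]
    by_contra hne
    obtain ⟨b, hb⟩ := (mem_range_sigma hα).2 hne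
    exact hi (Finset.mem_image.2 ⟨b, Finset.mem_univ _, hb⟩)
  rw [← Finset.sum_subset (Finset.subset_univ _) fun i _ hi => h0 i hi,
    Finset.sum_image fun _ _ _ _ hab => (sigma α hα).injective hab]
  simp only [extendZero_sigma]

theorem integral_eq_abs_det_mul_integral {M : Matrix (Fin s) (Fin s) ℝ} (hM : M.det ≠ 0)
    {g : EuclideanSpace ℝ (Fin s) → ℂ} (hg : Measurable g) :
    ∫ t : Fin s → ℝ, g (WithLp.toLp 2 (M *ᵥ t)) = ((|M.det| : ℝ) : ℂ)⁻¹ * ∫ x, g x := by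
  have hg' : Measurable fun y : Fin s → ℝ => g (WithLp.toLp 2 y) :=
    hg.comp (MeasurableEquiv.toLp 2 _).measurable
  have h1 : ∫ y : Fin s → ℝ, g (WithLp.toLp 2 y) = ∫ x, g x :=
    (PiLp.volume_preserving_toLp (Fin s)).integral_comp
      (MeasurableEquiv.toLp 2 (Fin s → ℝ)).measurableEmbedding g
  have h2 : ∫ y, g (WithLp.toLp 2 y) ∂(Measure.map (Matrix.toLin' M) volume) =
      ∫ t : Fin s → ℝ, g (WithLp.toLp 2 (M *ᵥ t)) := by
    rw [integral_map (LinearMap.continuous_of_finiteDimensional _).aemeasurable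
      hg'.aestronglyMeasurable]
    rfl
  rw [← h2, Real.map_matrix_volume_pi_eq_smul_volume_pi hM, integral_smul_measure, h1,
    ENNReal.toReal_ofReal (abs_nonneg _), abs_inv, Complex.real_smul]
  push_cast
  rfl

theorem measurable_greensTerm (a : ℝ × (Fin n → ℕ)) : Measurable (greensTerm Ξ a) := by
  unfold greensTerm
  split_ifs with h
  · refine Measurable.const_mul (Finset.measurable_prod _ fun j _ => ?_) _
    refine ((measurable_sgnPow _).comp ?_).div_const _
    have : Continuous fun x : EuclideanSpace ℝ (Fin s) =>
        (subMatrix Ξ a.2 h)⁻¹ *ᵥ x.ofLp :=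
      continuous_const.matrix_mulVec (PiLp.continuous_ofLp 2 _)
    exact (measurable_pi_apply j).comp this.measurable
  · exact measurable_const

/-- When `‖α‖₀ = s`, integration against the kernels is integration against the summand of the
Green's function. -/
theorem integral_greensTerm_mul (a : ℝ × (Fin n → ℕ)) (h : (supp a.2).card = s)
    (hdet : (subMatrix Ξ a.2 h).det ≠ 0) (f : 𝓢(EuclideanSpace ℝ (Fin s), ℂ)) :
    ∫ x, (greensTerm Ξ a x : ℂ) * f x = a.1 * kernIntegral Ξ a.2 f := by
  have hdet' : ((|(subMatrix Ξ a.2 h).det| : ℝ) : ℂ) ≠ 0 := by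
    exact_mod_cast abs_ne_zero.2 hdet
  have h1 := integral_eq_abs_det_mul_integral hdet
    (g := fun x => (greensTerm Ξ a x : ℂ) * f x)
    ((Complex.measurable_ofReal.comp (measurable_greensTerm a)).mul f.continuous.measurable)
  rw [kernIntegral, pi_kernMeasure_eq_map h, integral_map (measurable_extendZero h).aemeasurable
    (measurable_kernIntegrand _ f).aestronglyMeasurable, ← integral_const_mul]
  rw [eq_comm, inv_mul_eq_iff_eq_mul₀ hdet'] at h1
  rw [h1, ← integral_const_mul]
  refine integral_congr_ae (Filter.Eventually.of_forall fun t => ?_)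
  have hkern : ∏ i, kern (a.2 i) (extendZero a.2 h t i) =
      sgnPowVec t fun j => mu a.2 h j - 1 := by
    rw [prod_eq_prod_sigma h _ fun i hi => by rw [hi, kern]]
    refine Finset.prod_congr rfl fun b _ => ?_
    rw [extendZero_sigma]
    change kern (a.2 (sigma a.2 h b)) (t b) = sgnPow (t b) (a.2 (sigma a.2 h b) - 1) /
      ((a.2 (sigma a.2 h b) - 1).factorial : ℝ)
    -- Entries on the support are positive, so the truncated subtraction in μ - 1 is exact and
    -- matches the index shift in `kern`.
    obtain ⟨l, hl⟩ := Nat.exists_eq_succ_of_ne_zero ((mem_range_sigma h).1 ⟨b, rfl⟩)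
    rw [hl]
    rfl
  have hterm : greensTerm Ξ a (WithLp.toLp 2 (subMatrix Ξ a.2 h *ᵥ t)) =
      a.1 / |(subMatrix Ξ a.2 h).det| * sgnPowVec t fun j => mu a.2 h j - 1 := by
    rw [greensTerm, dif_pos h, Matrix.mulVec_mulVec,
      Matrix.nonsing_inv_mul _ (isUnit_iff_ne_zero.2 hdet), Matrix.one_mulVec]
  simp only [hkern, hterm, mulVec_extendZero]
  push_cast
  field_simp

end FullSupport

/-! ### Fourier transform and multiplication by the frequencies -/

section Fourier

open LineDeriv FourierTransform
open scoped Real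

variable {s n : ℕ} {Ξ : Matrix (Fin s) (Fin n) ℝ}

/-- The dilation relating the two conventions of the Fourier transform. -/
noncomputable def dilation (s : ℕ) : EuclideanSpace ℝ (Fin s) ≃L[ℝ] EuclideanSpace ℝ (Fin s) :=
  ContinuousLinearEquiv.smulLeft (Units.mk0 (2 * π)⁻¹ (by positivity))

theorem dilation_apply (x : EuclideanSpace ℝ (Fin s)) : dilation s x = (2 * π)⁻¹ • x := rfl

/-- `angularFourier` as a linear map on Schwartz functions. -/
noncomputable def angularFourierSchwartz (s : ℕ) :
    𝓢(EuclideanSpace ℝ (Fin s), ℂ) →ₗ[ℂ] 𝓢(EuclideanSpace ℝ (Fin s), ℂ) :=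
  (SchwartzMap.compCLMOfContinuousLinearEquiv ℂ (dilation s)).toLinearMap ∘ₗ
    (SchwartzMap.fourierTransformCLM ℂ).toLinearMap

theorem angularFourierSchwartz_eq (φ : 𝓢(EuclideanSpace ℝ (Fin s), ℂ)) :
    angularFourierSchwartz s φ =
      SchwartzMap.compCLMOfContinuousLinearEquiv ℂ (dilation s) (𝓕 φ) := rfl

theorem angularFourierSchwartz_apply (φ : 𝓢(EuclideanSpace ℝ (Fin s), ℂ))
    (x : EuclideanSpace ℝ (Fin s)) : angularFourierSchwartz s φ x = angularFourier φ x := by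
  rw [angularFourierSchwartz_eq, SchwartzMap.compCLMOfContinuousLinearEquiv_apply,
    Function.comp_apply, SchwartzMap.fourier_coe, Real.fourier_eq', angularFourier, dilation_apply]
  refine integral_congr_ae (.of_forall fun ω => ?_)
  dsimp only
  rw [inner_smul_right, smul_eq_mul]
  congr 2
  have : (π : ℂ) ≠ 0 := by exact_mod_cast Real.pi_ne_zero
  push_cast
  field_simp

/-- `w(j) = i ξ_j · ω`. -/
noncomputable def frequency (Ξ : Matrix (Fin s) (Fin n) ℝ) (j : Fin n)
    (ω : EuclideanSpace ℝ (Fin s)) : ℂ :=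
  I * ((∑ i, Ξ i j * ω i : ℝ) : ℂ)

theorem frequency_eq_inner (j : Fin n) (ω : EuclideanSpace ℝ (Fin s)) :
    frequency Ξ j ω = I * ((inner ℝ ω (WithLp.toLp 2 (Ξ.col j)) : ℝ) : ℂ) := by
  simp [frequency, PiLp.inner_apply]

theorem hasTemperateGrowth_frequency (j : Fin n) :
    (frequency Ξ j).HasTemperateGrowth := by
  have : frequency Ξ j = fun ω : EuclideanSpace ℝ (Fin s) =>
      I * Complex.ofRealCLM (inner ℝ ω (WithLp.toLp 2 (Ξ.col j))) := by
    funext ω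
    exact frequency_eq_inner j ω
  rw [this]
  exact (Function.HasTemperateGrowth.const I).mul
    (Complex.ofRealCLM.hasTemperateGrowth.comp (Function.hasTemperateGrowth_inner_left _))

theorem hasTemperateGrowth_monomial (δ : Fin n → ℕ) :
    Function.HasTemperateGrowth fun ω : EuclideanSpace ℝ (Fin s) =>
      ∏ j, frequency Ξ j ω ^ δ j := by
  classical
  induction (Finset.univ : Finset (Fin n)) using Finset.induction_on with
  | empty => simp [Function.HasTemperateGrowth.const]
  | insert j t hj ih =>
    simp only [Finset.prod_insert hj]
    exact ((hasTemperateGrowth_frequency j).pow _).mul ih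

/-- Multiplication by `w^δ`. -/
noncomputable def mulMonomial (Ξ : Matrix (Fin s) (Fin n) ℝ) (δ : Fin n → ℕ) :
    𝓢(EuclideanSpace ℝ (Fin s), ℂ) →ₗ[ℂ] 𝓢(EuclideanSpace ℝ (Fin s), ℂ) :=
  (SchwartzMap.smulLeftCLM ℂ fun ω => ∏ j, frequency Ξ j ω ^ δ j).toLinearMap

theorem mulMonomial_apply (δ : Fin n → ℕ) (φ : 𝓢(EuclideanSpace ℝ (Fin s), ℂ))
    (ω : EuclideanSpace ℝ (Fin s)) :
    mulMonomial Ξ δ φ ω = (∏ j, frequency Ξ j ω ^ δ j) * φ ω :=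
  SchwartzMap.smulLeftCLM_apply_apply (hasTemperateGrowth_monomial δ) φ ω

theorem mulMonomial_single_apply (j : Fin n) (φ : 𝓢(EuclideanSpace ℝ (Fin s), ℂ))
    (ω : EuclideanSpace ℝ (Fin s)) :
    mulMonomial Ξ (Pi.single j 1) φ ω = frequency Ξ j ω * φ ω := by
  rw [mulMonomial_apply, Finset.prod_eq_single j (fun i _ hi => by simp [hi]) (by simp)]
  simp

/-- Differentiating exp(-i ω · x) along ξ_j brings down -w(j). The dilation factor (2π)⁻¹ cancels
the 2π of the unitary convention. -/
theorem angularFourierSchwartz_mulMonomial_single (j : Fin n)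
    (φ : 𝓢(EuclideanSpace ℝ (Fin s), ℂ)) :
    angularFourierSchwartz s (mulMonomial Ξ (Pi.single j 1) φ) =
      -∂_{(WithLp.toLp 2 (Ξ.col j) : EuclideanSpace ℝ (Fin s))} (angularFourierSchwartz s φ) := by
  set m : EuclideanSpace ℝ (Fin s) := WithLp.toLp 2 (Ξ.col j) with hm
  rw [angularFourierSchwartz_eq φ, SchwartzMap.lineDerivOp_compCLMOfContinuousLinearEquiv,
    SchwartzMap.lineDerivOp_fourier_eq, ← angularFourierSchwartz_eq, ← map_neg]
  congr 1
  ext ω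
  have htemp : (fun x : EuclideanSpace ℝ (Fin s) =>
      (inner ℝ x (dilation s m) : ℝ)).HasTemperateGrowth :=
    Function.hasTemperateGrowth_inner_left _
  rw [mulMonomial_single_apply, frequency_eq_inner, ← hm, neg_smul, neg_neg, smul_apply,
    SchwartzMap.smulLeftCLM_apply_apply htemp, dilation_apply, inner_smul_right,
    Complex.real_smul, smul_eq_mul]
  have : (π : ℂ) ≠ 0 := by exact_mod_cast Real.pi_ne_zero
  push_cast
  field_simp

theorem isLinearMap_kernIntegral {γ : Fin n → ℕ} (h : IsIndep Ξ γ) :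
    IsLinearMap ℂ fun f : 𝓢(EuclideanSpace ℝ (Fin s), ℂ) => kernIntegral Ξ γ f := by
  refine ⟨fun f g => ?_, fun c f => ?_⟩
  · simp only [kernIntegral, add_apply, mul_add]
    exact integral_add (h.integrable f) (h.integrable g)
  · simp only [kernIntegral, smul_apply, smul_eq_mul, ← integral_const_mul]
    refine integral_congr_ae (.of_forall fun t => ?_)
    ring

/-- Cancellation is the analytic content: the transform turns w(i) into -∂ along ξ_i, which lowers
the i-th kernel by one order. -/
theorem isReciprocalSystem_kernIntegral (Ξ : Matrix (Fin s) (Fin n) ℝ) :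
    IsReciprocalSystem Ξ (mulMonomial Ξ)
      (fun γ φ => kernIntegral Ξ γ (angularFourierSchwartz s φ)) where
  mul_zero φ := by
    ext ω
    simp [mulMonomial_apply]
  mul_add δ ε φ := by
    ext ω
    simp only [mulMonomial_apply, Pi.add_apply, pow_add, Finset.prod_mul_distrib]
    ring
  sum_eq_zero v hv φ := by
    ext ω
    rw [sum_apply]
    simp only [smul_apply, mulMonomial_single_apply, smul_eq_mul, frequency]
    have h0 : ∑ j, v j * ∑ i, Ξ i j * ω i = 0 := by
      have : ∑ i, ω i * (Ξ *ᵥ v) i = 0 := by simp [hv]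
      rw [← this]
      simp only [Matrix.mulVec, dotProduct, Finset.mul_sum]
      rw [Finset.sum_comm]
      refine Finset.sum_congr rfl fun i _ => Finset.sum_congr rfl fun j _ => by ring
    calc ∑ j, (v j : ℂ) * (I * ((∑ i, Ξ i j * ω i : ℝ) : ℂ) * φ ω)
        = I * ((∑ j, v j * ∑ i, Ξ i j * ω i : ℝ) : ℂ) * φ ω := by
          rw [Complex.ofReal_sum, Finset.mul_sum, Finset.sum_mul]
          refine Finset.sum_congr rfl fun j _ => ?_
          push_cast
          ring
      _ = (0 : 𝓢(EuclideanSpace ℝ (Fin s), ℂ)) ω := by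
          rw [h0]
          simp
  isLinearMap γ h := by
    have := isLinearMap_kernIntegral h
    exact ⟨fun φ ψ => by simp only [map_add]; exact this.map_add _ _,
      fun c φ => by simp only [map_smul]; exact this.map_smul _ _⟩
  cancel γ i φ h := by
    rw [angularFourierSchwartz_mulMonomial_single]
    exact kernIntegral_add_single γ i h _

theorem symbol_eq_prod_frequency (ω : EuclideanSpace ℝ (Fin s)) :
    symbol Ξ ω = ∏ j, frequency Ξ j ω := rfl

theorem mulMonomial_one_apply (φ : 𝓢(EuclideanSpace ℝ (Fin s), ℂ))
    (ω : EuclideanSpace ℝ (Fin s)) :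
    mulMonomial Ξ (fun _ => 1) φ ω = symbol Ξ ω * φ ω := by
  simp [mulMonomial_apply, symbol_eq_prod_frequency]

theorem kernIntegral_zero_angularFourier (φ : 𝓢(EuclideanSpace ℝ (Fin s), ℂ)) :
    kernIntegral Ξ 0 (angularFourierSchwartz s φ) = ∫ ω, φ ω := by
  rw [kernIntegral_zero, angularFourierSchwartz_apply, angularFourier]
  simp

end Fourier

/-! ### Measurability, polynomial growth and summation over the family -/

section Growth

variable {s n : ℕ} {Ξ : Matrix (Fin s) (Fin n) ℝ}

/-- Polynomial growth. -/
def HasPolynomialGrowth {E : Type*} [Norm E] (G : E → ℝ) : Prop :=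
  ∃ (C : ℝ) (N : ℕ), ∀ x, |G x| ≤ C * (1 + ‖x‖) ^ N

namespace HasPolynomialGrowth

variable {E : Type*} [NormedAddCommGroup E] {F G : E → ℝ}

theorem exists_nonneg (hG : HasPolynomialGrowth G) :
    ∃ (C : ℝ) (N : ℕ), 0 ≤ C ∧ ∀ x, |G x| ≤ C * (1 + ‖x‖) ^ N := by
  obtain ⟨C, N, h⟩ := hG
  refine ⟨|C|, N, abs_nonneg C, fun x => (h x).trans ?_⟩
  gcongr
  exact le_abs_self C

theorem const (c : ℝ) : HasPolynomialGrowth fun _ : E => c := ⟨|c|, 0, fun x => by simp⟩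

theorem add (hF : HasPolynomialGrowth F) (hG : HasPolynomialGrowth G) :
    HasPolynomialGrowth fun x => F x + G x := by
  obtain ⟨C, N, hC, h⟩ := hF.exists_nonneg
  obtain ⟨D, M, hD, h'⟩ := hG.exists_nonneg
  refine ⟨C + D, N + M, fun x => (abs_add_le _ _).trans ?_⟩
  have h1 : 1 ≤ 1 + ‖x‖ := by linarith [norm_nonneg x]
  rw [add_mul]
  refine add_le_add ((h x).trans ?_) ((h' x).trans ?_)
  · gcongr
    exact Nat.le_add_right _ _
  · gcongr
    exact Nat.le_add_left _ _

theorem mul (hF : HasPolynomialGrowth F) (hG : HasPolynomialGrowth G) :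
    HasPolynomialGrowth fun x => F x * G x := by
  obtain ⟨C, N, hC, h⟩ := hF.exists_nonneg
  obtain ⟨D, M, hD, h'⟩ := hG.exists_nonneg
  refine ⟨C * D, N + M, fun x => ?_⟩
  rw [abs_mul, pow_add, mul_mul_mul_comm]
  exact mul_le_mul (h x) (h' x) (abs_nonneg _) (by positivity)

theorem prod {ι : Type*} (t : Finset ι) {F : ι → E → ℝ} (hF : ∀ i, HasPolynomialGrowth (F i)) :
    HasPolynomialGrowth fun x => ∏ i ∈ t, F i x := by
  classical
  induction t using Finset.induction_on with
  | empty => simpa using const (E := E) 1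
  | insert i t hi ih =>
    simp only [Finset.prod_insert hi]
    exact (hF i).mul ih

theorem integrable_mul {E : Type*} [NormedAddCommGroup E] [NormedSpace ℝ E]
    [FiniteDimensional ℝ E] [MeasurableSpace E] [BorelSpace E] {μ : Measure E}
    [μ.HasTemperateGrowth] {G : E → ℝ} (hG : HasPolynomialGrowth G) (hm : Measurable G)
    (f : 𝓢(E, ℂ)) : Integrable (fun x => (G x : ℂ) * f x) μ := by
  obtain ⟨C, N, hC, h⟩ := hG.exists_nonneg
  have hint : Integrable (fun x => C * 2 ^ (N - 1) * (‖x‖ ^ 0 * ‖f x‖ + ‖x‖ ^ N * ‖f x‖)) μ :=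
    ((f.integrable_pow_mul μ 0).add (f.integrable_pow_mul μ N)).const_mul _
  refine hint.mono'
    ((Complex.measurable_ofReal.comp hm).mul f.continuous.measurable).aestronglyMeasurable
    (.of_forall fun x => ?_)
  rw [norm_mul, Complex.norm_real, Real.norm_eq_abs]
  calc |G x| * ‖f x‖ ≤ C * (1 + ‖x‖) ^ N * ‖f x‖ := by gcongr; exact h x
    _ ≤ C * (2 ^ (N - 1) * (1 ^ N + ‖x‖ ^ N)) * ‖f x‖ := by
        gcongr
        exact add_pow_le zero_le_one (norm_nonneg x) N
    _ = _ := by rw [one_pow, pow_zero]; ring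

end HasPolynomialGrowth

theorem hasPolynomialGrowth_greensTerm (a : ℝ × (Fin n → ℕ)) :
    HasPolynomialGrowth (greensTerm Ξ a) := by
  unfold greensTerm
  split_ifs with h
  · refine (HasPolynomialGrowth.const _).mul (HasPolynomialGrowth.prod _ fun j => ?_)
    simp only [div_eq_mul_inv]
    refine HasPolynomialGrowth.mul ?_ (HasPolynomialGrowth.const _)
    let L : EuclideanSpace ℝ (Fin s) →L[ℝ] ℝ := LinearMap.toContinuousLinearMap
      (LinearMap.proj j ∘ₗ (subMatrix Ξ a.2 h)⁻¹.mulVecLin ∘ₗ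
        (WithLp.linearEquiv 2 ℝ (Fin s → ℝ)).toLinearMap)
    refine ⟨‖L‖ ^ (mu a.2 h j - 1), mu a.2 h j - 1, fun x => (abs_sgnPow_le _ _).trans ?_⟩
    rw [← mul_pow]
    have hx : |L x| ≤ ‖L‖ * ‖x‖ := L.le_opNorm x
    refine pow_le_pow_left₀ (abs_nonneg _) (hx.trans ?_) _
    gcongr
    linarith
  · exact HasPolynomialGrowth.const 0

theorem measurable_and_hasPolynomialGrowth_sum (S : Multiset (ℝ × (Fin n → ℕ))) :
    (Measurable fun x => (S.map fun a => greensTerm Ξ a x).sum) ∧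
      HasPolynomialGrowth fun x => (S.map fun a => greensTerm Ξ a x).sum := by
  induction S using Multiset.induction_on with
  | empty => exact ⟨measurable_const, HasPolynomialGrowth.const 0⟩
  | cons a S ih =>
    simp only [Multiset.map_cons, Multiset.sum_cons]
    exact ⟨(measurable_greensTerm a).add ih.1, (hasPolynomialGrowth_greensTerm a).add ih.2⟩

theorem integral_sum_greensTerm_mul (S : Multiset (ℝ × (Fin n → ℕ)))
    (hS : ∀ a ∈ S, ∃ h : (supp a.2).card = s, (subMatrix Ξ a.2 h).det ≠ 0)
    (f : 𝓢(EuclideanSpace ℝ (Fin s), ℂ)) :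
    ∫ x, (((S.map fun a => greensTerm Ξ a x).sum : ℝ) : ℂ) * f x =
      (S.map fun a => (a.1 : ℂ) * kernIntegral Ξ a.2 f).sum := by
  induction S using Multiset.induction_on with
  | empty => simp
  | cons a S ih =>
    obtain ⟨h, hdet⟩ := hS a (Multiset.mem_cons_self a S)
    have hsum := measurable_and_hasPolynomialGrowth_sum (Ξ := Ξ) S
    simp only [Multiset.map_cons, Multiset.sum_cons, Complex.ofReal_add, add_mul]
    rw [integral_add
      ((hasPolynomialGrowth_greensTerm a).integrable_mul (measurable_greensTerm a) f)
      (hsum.2.integrable_mul hsum.1 f), integral_greensTerm_mul a h hdet f,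
      ih fun b hb => hS b (Multiset.mem_cons_of_mem hb)]

end Growth

/-! ### Division by the symbol away from its zeros -/

section Quotient

variable {s n : ℕ} {Ξ : Matrix (Fin s) (Fin n) ℝ}

theorem contDiff_symbol : ContDiff ℝ (⊤ : ℕ∞) (symbol Ξ) := by
  have := (hasTemperateGrowth_monomial (Ξ := Ξ) fun _ => 1).1
  simp only [pow_one] at this
  exact this

/-- The quotient is smooth near the support of φ, where the symbol does not vanish, and locally zero
elsewhere. It reduces the formula off the zeros to the multiplication identity. -/
theorem exists_schwartzMap_div_symbol (φ : 𝓢(EuclideanSpace ℝ (Fin s), ℂ))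
    (hc : HasCompactSupport φ) (hsupp : tsupport φ ⊆ {ω | symbol Ξ ω ≠ 0}) :
    ∃ ψ : 𝓢(EuclideanSpace ℝ (Fin s), ℂ),
      (∀ ω, ψ ω = φ ω / symbol Ξ ω) ∧ ∀ ω, symbol Ξ ω * ψ ω = φ ω := by
  have hsmooth : ContDiff ℝ (⊤ : ℕ∞) fun ω => φ ω * (symbol Ξ ω)⁻¹ := by
    refine contDiff_iff_contDiffAt.2 fun ω => ?_
    by_cases hω : ω ∈ tsupport φ
    · exact (φ.smooth ⊤).contDiffAt.mul (contDiff_symbol.contDiffAt.inv (hsupp hω))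
    · refine contDiffAt_const (c := (0 : ℂ)) |>.congr_of_eventuallyEq ?_
      filter_upwards [notMem_tsupport_iff_eventuallyEq.1 hω] with x hx
      rw [hx, Pi.zero_apply, zero_mul]
  refine ⟨(hc.mul_right (f' := fun ω => (symbol Ξ ω)⁻¹)).toSchwartzMap hsmooth,
    fun ω => (div_eq_mul_inv _ _).symm, fun ω => ?_⟩
  change symbol Ξ ω * (φ ω * (symbol Ξ ω)⁻¹) = φ ω
  by_cases h0 : symbol Ξ ω = 0
  · rw [h0, zero_mul]
    exact (image_eq_zero_of_notMem_tsupport fun h => hsupp h h0).symm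
  · field_simp

end Quotient

end BoxSpline

/-! ### Assembly of the Green's function -/

theorem mainTheorem2 {s n : ℕ} (Ξ : Matrix (Fin s) (Fin n) ℝ) (hrank : Ξ.rank = s)
    (hcol : ∀ j, Ξ.col j ≠ 0)
    (K : Matrix (Fin n) (Fin (n - s)) ℝ) (hK : BoxSpline.IsKernelMatrix Ξ K)
    (ν : (Fin n → ℕ) → Fin n → ℝ)
    (hν : ∀ α, s < (BoxSpline.supp α).card → BoxSpline.IsNuVector K α (ν α)) :
    (∀ a ∈ BoxSpline.P ν (n - s), ∃ h : (BoxSpline.supp a.2).card = s,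
      (BoxSpline.subMatrix Ξ a.2 h).det ≠ 0) ∧
    BoxSpline.IsGreensFunction Ξ (BoxSpline.greensSum Ξ ν) := by
  open BoxSpline in
  have hν' := fun α hα => (hν α hα).isRelation_and_isLead hK
  have hsn : s ≤ n := by
    rw [← hrank]
    simpa using Ξ.rank_le_width
  have hP : ∀ a ∈ P ν (n - s), ∃ h : (supp a.2).card = s, (subMatrix Ξ a.2 h).det ≠ 0 := by
    intro a ha
    have hnode := isNode_of_mem_P hrank hν' (n - s) (by omega) a ha
    have hcard : (supp a.2).card = s := by
      have := hnode.card
      omega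
    exact ⟨hcard, hnode.det_ne_zero hcard⟩
  have hmain : ∀ φ : 𝓢(EuclideanSpace ℝ (Fin s), ℂ),
      ∫ x, (greensSum Ξ ν x : ℂ) * angularFourier (fun ω => symbol Ξ ω * φ ω) x = ∫ ω, φ ω := by
    intro φ
    -- The sum becomes ∑ c T_α(w^(1,…,1) φ), which the partial fractions collapse to T_0(φ) = ∫ φ.
    have h1 := integral_sum_greensTerm_mul (Ξ := Ξ) _ hP
      (angularFourierSchwartz s (mulMonomial Ξ (fun _ => 1) φ))
    rw [(isReciprocalSystem_kernIntegral Ξ).sum_P hrank hcol hν' φ,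
      kernIntegral_zero_angularFourier] at h1
    rw [← h1]
    have h2 : (fun ω => symbol Ξ ω * φ ω) = mulMonomial Ξ (fun _ => 1) φ :=
      funext fun ω => (mulMonomial_one_apply φ ω).symm
    simp only [angularFourierSchwartz_apply, h2]
    rfl
  refine ⟨hP, (measurable_and_hasPolynomialGrowth_sum _).1,
    (measurable_and_hasPolynomialGrowth_sum _).2, fun φ hc hsupp => ?_, hmain⟩
  obtain ⟨ψ, hψ, hψ'⟩ := exists_schwartzMap_div_symbol φ hc hsupp
  have := hmain ψ
  simp only [hψ'] at this
  rw [this]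
  exact integral_congr_ae (.of_forall hψ)
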